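/- Setting. Let $d\ge 1$, let $\mathcal X\subseteq\mathbb R^d$ be a measurable instance space with the Euclidean metric, and let $D$ be a probability distribution on labeled examples $(X,Y)\in\mathcal X\times\{0,1\}$, with marginal $\mu$ on $\mathcal X$ and conditional label probability $\eta(x)=\Pr(Y=1\mid X=x)$ (any measurable $[0,1]$-valued version). Below, $B^o(x,r)$ and $B(x,r)$ are the open and the closed ball in $\mathcal X$. The robustness radius of $f:\mathcal X\to\{0,1\}$ at $x$ is $\rho(f,x)=\inf\{r : \exists x'\in B(x,r),\ f(x')\ne f(x)\}\in[0,\infty]$, and the astuteness of $f$ at radius $r$ is $\Pr_{(x,y)\sim D}(\rho(f,x)\ge r,\ f(x)=y)$. For $p\in\mathbb R$ let $r_p(x)=\inf\{r\in[0,\infty] : \mu(B(x,r))\ge p\}$ (with $\inf\emptyset=\infty$), and let $$\mathcal X^+_{r,\Delta,p}=\{x\in\operatorname{supp}\mu : \forall x'\in B^o(x,r)\ \forall x''\in B(x',r_p(x')),\ \eta(x'')>\tfrac12+\Delta\},$$ $$\mathcal X^-_{r,\Delta,p}=\{x\in\operatorname{supp}\mu : \forall x'\in B^o(x,r)\ \forall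 x''\in B(x',r_p(x')),\ \eta(x'')<\tfrac12-\Delta\}.$$ For a training set $S_n$ of $n$ independent draws $(X_i,Y_i)$ from $D$ and $1\le k\le n$, the $k$-NN classifier gives $x$ the label $1$ if $Y^{(1)}(x)+\dots+Y^{(k)}(x)\ge k/2$ and the label $0$ otherwise, where $Y^{(i)}(x)$ is the label of the $i$-th nearest training point to $x$, equal distances being resolved in favor of the smaller index. For $n\ge1$, $k\le n$, $r>0$, $\Delta>0$, $p$ and $0<\delta<1$, consider the two guarantees: (R) with probability at least $1-3\delta$ over $S_n$, $k$-NN has robustness radius at least $r$ at every $x\in\mathcal X^+_{r,\Delta,p}\cup\mathcal X^-_{r,\Delta,p}$; (A) with probability at least $1-\delta$ over $S_n$, the astuteness of $k$-NN at radius $r$ is at least $\mathbb E[\eta(X)\mathbf 1(X\in\mathcal X^+_{r,\Delta,p})]+\mathbb E[(1-\eta(X))\mathbf 1(X\in\mathcal X^-_{r,\Delta,p})]$. Theorem. (1) There are universal constants $C_1,C_2>0$ such that (R) and (A) hold for all $d,\mathcal X,D,\eta,n,r,\delta$, all $\Delta=\Delta_n$, all $k=k_n\le n$ and all $p=p_n$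 with $$k_n\ge C_1\frac{\sqrt{dn\log n+n\log(1/\delta)}}{\Delta_n},\qquad p_n\ge\frac{k_n}{n}\Bigl(1+C_2\sqrt{\tfrac{d\log n+\log(1/\delta)}{k_n}}\Bigr).$$ (2) There is a universal constant $C_0>0$ such that, with $a_n=\frac{C_0}{n}(d\log n+\log(1/\delta))$, $b_n=C_0\sqrt{\frac{d\log n+\log(1/\delta)}{n}}$ and $\beta_n=\sqrt{\frac4n((d+1)\ln 2n+\ln(8/\delta))}$, (R) and (A) hold for all $d,\mathcal X,D,\eta,n,r,\delta$, all $\Delta=\Delta_n$ and all $k=k_n\le n$ with $$\frac{k_n}{n}\ge\frac{2\beta_n+b_n+\sqrt{(2\beta_n+b_n)^2+2\Delta_n(2\beta_n^2+a_n)}}{\Delta_n},$$ where $p=p_n=\frac{k_n}{n}+\frac{C_0}{n}\bigl(d\log n+\log(1/\delta)+\sqrt{k_n(d\log n+\log(1/\delta))}\bigr)$. (3) The regions in (R) approach the corresponding robustness regions $\mathcal X^\pm_{r,0,0}$ of the Bayes optimal classifier, in this sense: if $\mathcal X$ is closed and contained in $\operatorname{supp}\mu$, $\eta$ is continuous on $\mathcal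 X$, $r>0$, $0<\Delta_n\to0$ and $p_n\to0$, then $\mathcal X^\pm_{r,\Delta_n,p_n}\subseteq\mathcal X^\pm_{r,0,0}$ for all $n$, and for every $s<r$ each $x\in\mathcal X^\pm_{r,0,0}$ lies in $\mathcal X^\pm_{s,\Delta_n,p_n}$ for all sufficiently large $n$. -/

import Mathlib

open MeasureTheory Filter Topology
open scoped ENNReal

noncomputable section

namespace KNN

/-- `d`-dimensional Euclidean space. -/
abbrev E (d : ℕ) : Type := EuclideanSpace ℝ (Fin d)

/-- Labeled examples; the label space is `{0, 1}`. -/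
abbrev Example (d : ℕ) : Type := E d × Fin 2

/-- A training set `(X₁, Y₁), …, (Xₙ, Yₙ)`. -/
abbrev Sample (d n : ℕ) : Type := Fin n → Example d

/-- The law of a training set of `n` independent draws from `D`. -/
def sampleLaw {d : ℕ} (D : Measure (Example d)) (n : ℕ) : Measure (Sample d n) :=
  Measure.pi fun _ => D

/-- `η` is a version of the conditional probability of the label `1` given the instance, for the
data distribution `D`, whose marginal over instances is `D.fst`. -/
structure IsCondLabelProb {d : ℕ} (D : Measure (Example d)) (η : E d → ℝ) : Prop where
  measurable : Measurable η
  mem_Icc : ∀ x, η x ∈ Set.Icc (0 : ℝ) 1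
  apply_prod_one : ∀ A : Set (E d), MeasurableSet A →
    D (A ×ˢ {1}) = ∫⁻ x in A, ENNReal.ofReal (η x) ∂D.fst

/-- The robustness radius of `f` at `x`, over the instance space `𝒳`: the infimum of all `r` such
that some `x' ∈ 𝒳` in the closed ball of radius `r` around `x` has another label
(`∞` if there is none). -/
def robustnessRadius {d : ℕ} (𝒳 : Set (E d)) (f : E d → Fin 2) (x : E d) : ℝ≥0∞ :=
  sInf {r : ℝ≥0∞ | ∃ x' ∈ 𝒳, edist x' x ≤ r ∧ f x ≠ f x'}

/-- The astuteness of `f` at radius `r` with respect to `D`. -/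
def astuteness {d : ℕ} (𝒳 : Set (E d)) (D : Measure (Example d)) (f : E d → Fin 2) (r : ℝ) : ℝ :=
  D.real {z | ENNReal.ofReal r ≤ robustnessRadius 𝒳 f z.1 ∧ f z.1 = z.2}

/-- The training indices ordered by increasing distance of the instances to `x`
(`Tuple.sort` puts the smaller index first when distances are equal): `nnIndex S x i` is the index
of the `(i+1)`-st nearest neighbor of `x`. -/
def nnIndex {d n : ℕ} (S : Sample d n) (x : E d) : Equiv.Perm (Fin n) :=
  Tuple.sort fun i => dist x (S i).1

/-- The `k`-nearest neighbor classifier: label `1` iff `Y⁽¹⁾(x) + … + Y⁽ᵏ⁾(x) ≥ k / 2`. -/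
def knn {d n : ℕ} (k : ℕ) (S : Sample d n) (x : E d) : Fin 2 :=
  if (k : ℝ) / 2 ≤ ∑ i ∈ Finset.univ.filter (fun i : Fin n => i.val < k),
      (((S (nnIndex S x i)).2 : ℕ) : ℝ) then 1 else 0

/-- The probability radius `r_p(x) = inf {r | μ (B(x, r)) ≥ p}` with values in `[0, ∞]`. -/
def probRadius {d : ℕ} (μ : Measure (E d)) (p : ℝ) (x : E d) : ℝ≥0∞ :=
  sInf {r : ℝ≥0∞ | ENNReal.ofReal p ≤ μ {x' | edist x' x ≤ r}}

/-- The `r`-robust `(p, Δ)`-strict interior of the class `1`. -/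
def strictInteriorPos {d : ℕ} (𝒳 : Set (E d)) (μ : Measure (E d)) (η : E d → ℝ)
    (r Δ p : ℝ) : Set (E d) :=
  {x | x ∈ 𝒳 ∧ x ∈ μ.support ∧ ∀ x' ∈ 𝒳, dist x' x < r →
    ∀ x'' ∈ 𝒳, edist x'' x' ≤ probRadius μ p x' → 1 / 2 + Δ < η x''}

/-- The `r`-robust `(p, Δ)`-strict interior of the class `0`. -/
def strictInteriorNeg {d : ℕ} (𝒳 : Set (E d)) (μ : Measure (E d)) (η : E d → ℝ)
    (r Δ p : ℝ) : Set (E d) :=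
  {x | x ∈ 𝒳 ∧ x ∈ μ.support ∧ ∀ x' ∈ 𝒳, dist x' x < r →
    ∀ x'' ∈ 𝒳, edist x'' x' ≤ probRadius μ p x' → η x'' < 1 / 2 - Δ}

/-- `good` holds with probability at least `q`: it holds on a measurable event of probability
at least `q`. -/
def HoldsWithProb {Ω : Type*} [MeasurableSpace Ω] (P : Measure Ω) (q : ℝ) (good : Ω → Prop) :
    Prop :=
  ∃ A : Set Ω, MeasurableSet A ∧ q ≤ P.real A ∧ ∀ ω ∈ A, good ω

/-- With probability at least `1 - 3 * δ` over the training set, `k`-NN has robustness radius at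
least `r` at all points of the two strict interiors. -/
def RobustnessGuarantee {d : ℕ} (𝒳 : Set (E d)) (D : Measure (Example d)) (η : E d → ℝ)
    (n k : ℕ) (r Δ p δ : ℝ) : Prop :=
  HoldsWithProb (sampleLaw D n) (1 - 3 * δ) fun S =>
    ∀ x ∈ strictInteriorPos 𝒳 D.fst η r Δ p ∪ strictInteriorNeg 𝒳 D.fst η r Δ p,
      ENNReal.ofReal r ≤ robustnessRadius 𝒳 (knn k S) x

/-- With probability at least `1 - δ` over the training set, the astuteness of `k`-NN at radius `r`
is at least `𝔼[η(X) 1(X ∈ 𝒳⁺)] + 𝔼[(1 - η(X)) 1(X ∈ 𝒳⁻)]`. -/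
def AstutenessGuarantee {d : ℕ} (𝒳 : Set (E d)) (D : Measure (Example d)) (η : E d → ℝ)
    (n k : ℕ) (r Δ p δ : ℝ) : Prop :=
  HoldsWithProb (sampleLaw D n) (1 - δ) fun S =>
    (∫ x in strictInteriorPos 𝒳 D.fst η r Δ p, η x ∂D.fst) +
      (∫ x in strictInteriorNeg 𝒳 D.fst η r Δ p, (1 - η x) ∂D.fst)
      ≤ astuteness 𝒳 D (knn k S) r

/-- `a_n = (C₀ / n) (d log n + log (1/δ))`. -/
def aTerm (C₀ : ℝ) (d n : ℕ) (δ : ℝ) : ℝ :=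
  C₀ / n * (d * Real.log n + Real.log (1 / δ))

/-- `b_n = C₀ √((d log n + log (1/δ)) / n)`. -/
def bTerm (C₀ : ℝ) (d n : ℕ) (δ : ℝ) : ℝ :=
  C₀ * √((d * Real.log n + Real.log (1 / δ)) / n)

/-- `β_n = √((4/n) ((d+1) log (2n) + log (8/δ)))`. -/
def betaTerm (d n : ℕ) (δ : ℝ) : ℝ :=
  √(4 / n * ((d + 1) * Real.log (2 * n) + Real.log (8 / δ)))

end KNN

end

/-!
# Robustness and astuteness of nearest-neighbor classification

Write `L = d log n + log (1 / δ)`. The third assertion is a compactness argument; the first two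
follow from one event of probability at least `1 - δ`, on which `k`-NN takes the label of each
strict interior on the whole `r`-neighborhood of that interior (`IsRobust`). Such a classifier is
robust at all points of the interiors (`IsRobust.le_robustnessRadius`), and correct there as often
as `η` and `1 - η` say (`IsRobust.le_astuteness`).

A sample is good for two reasons.

* Every closed ball of probability at least `p` contains `k` sample points, so the `k` nearest
  neighbors of `x'` lie within the probability radius of `x'`, where `η` is away from `1 / 2`. This
  is a relative deviation bound, `pi_exists_sparse_le`. On the bad event, for some ball `A`, the
  variable `exp (t ((1 - 2 t) ∑ 1_A(X'_i) - ∑ 1_A(X_i)))` has large mean over an independent ghost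
  sample `X'`, by Jensen's inequality. Summed over all traces of balls on the double sample, it has
  mean at most the number of traces: by symmetry one may swap `X_i` and `X'_i` at random, and each
  swap contributes a factor of mean at most `1` because
  `exp (t (1 - 2 t)) + exp (-t) ≤ 2` (`exp_swap_le`).
* The `k` nearest neighbors vote as `η` suggests. Given the instances, the labels are independent,
  and `sampleLaw_exists_trace_le` is the union bound over the index sets that can occur as sets of
  nearest neighbors, with Chernoff's bound `exp (-k Δ ^ 2)` for each of them.

In both cases the number of traces is polynomial in `n` of degree `d + 3`: half-spaces of a
`V`-dimensional space shatter at most `V` points (`Shatters.card_le_finrank`), the Sauer–Shelah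
lemma bounds the number of traces (`card_traces_le`), and balls become half-spaces under
`x ↦ (x, ‖x‖ ^ 2, 1)`. Breaking ties by the index adds one more coordinate: a set of nearest
neighbors is cut out by `‖x‖ ^ 2 - 2 ⟪q, x⟫ + ε i < c` for a small `ε > 0` (`nnSet_mem_traces`).
Since these conditions are open, parameters from a countable dense set suffice, which settles all
questions of measurability of the events.

For `n ≥ 2` the number of traces is at most `exp (12 L)`, and both exponents are at least `16 L`.
The second form of the conditions implies the first, since the term `b_n` alone dominates.
-/

namespace KNN

/-! ### Traces of half-spaces on finite point sets -/

open Classical in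
/-- The family of the subsets of a finite set `J` cut out by the members of a family `B` of
predicates on `J`. -/
noncomputable def traces {ι J : Type*} [Fintype J] (B : ι → J → Prop) : Finset (Finset J) :=
  Finset.univ.filter fun I => ∃ w, ∀ j, j ∈ I ↔ B w j

lemma mem_traces {ι J : Type*} [Fintype J] {B : ι → J → Prop} {I : Finset J} :
    I ∈ traces B ↔ ∃ w, ∀ j, j ∈ I ↔ B w j := by
  simp [traces]

lemma sum_choose_Iic_le (m V : ℕ) : ∑ i ∈ Finset.Iic V, m.choose i ≤ (m + 1) ^ V := by
  induction V with
  | zero => simp [show Finset.Iic 0 = {0} from rfl]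
  | succ V ih =>
    have h : Finset.Iic (V + 1) = insert (V + 1) (Finset.Iic V) := by
      ext i; simp only [Finset.mem_Iic, Finset.mem_insert]; omega
    rw [h, Finset.sum_insert (by simp)]
    have h1 : m.choose (V + 1) ≤ m * (m + 1) ^ V :=
      (Nat.choose_le_pow m (V + 1)).trans (by
        rw [pow_succ, mul_comm]
        exact Nat.mul_le_mul_left _ (Nat.pow_le_pow_left (Nat.le_succ m) V))
    calc _ ≤ m * (m + 1) ^ V + (m + 1) ^ V := Nat.add_le_add h1 ih
      _ = (m + 1) ^ (V + 1) := by ring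

/-- Half-spaces through the origin of a `V`-dimensional space shatter at most `V` points: on a
linearly dependent set of points, the part with positive coefficients cannot be cut off. -/
lemma Shatters.card_le_finrank {ι J F : Type*} [Fintype J] [DecidableEq J] [AddCommGroup F]
    [Module ℝ F] [FiniteDimensional ℝ F] {φ : J → F} {B : ι → J → Prop}
    (hB : ∀ w, ∃ l : F →ₗ[ℝ] ℝ, ∀ j, B w j ↔ 0 < l (φ j)) {s : Finset J}
    (hs : (traces B).Shatters s) : s.card ≤ Module.finrank ℝ F := by
  by_contra! hlt
  obtain ⟨c, hc, j₀, hpos⟩ : ∃ c : s → ℝ, ∑ j, c j • φ j = 0 ∧ ∃ j, 0 < c j := by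
    have hdep : ¬ LinearIndependent ℝ (fun j : s => φ j) := fun h => by
      have := h.fintype_card_le_finrank
      simp at this
      omega
    obtain ⟨c, hc, j, hj⟩ := Fintype.not_linearIndependent_iff.1 hdep
    rcases lt_or_gt_of_ne hj with h | h
    · exact ⟨-c, by simpa [-Finset.univ_eq_attach] using hc, j, by simpa using h⟩
    · exact ⟨c, hc, j, h⟩
  obtain ⟨u, hu, hsu⟩ := hs (t := s.filter fun j => ∃ h : j ∈ s, 0 < c ⟨j, h⟩)
    (Finset.filter_subset _ _)
  obtain ⟨w, hw⟩ := mem_traces.1 hu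
  obtain ⟨l, hl⟩ := hB w
  have key : ∀ j : s, 0 < c j ↔ 0 < l (φ j) := fun j => by
    rw [← hl, ← hw]
    have := congrArg (fun t => (j : J) ∈ t) hsu
    simpa using this.symm
  have hsum : ∑ j, c j * l (φ j) = 0 := by
    have := congrArg l hc
    simpa using this
  have hnn : ∀ j ∈ Finset.univ, 0 ≤ c j * l (φ j) := fun j _ => by
    by_cases h : 0 < c j
    · exact (mul_pos h ((key j).1 h)).le
    · exact mul_nonneg_of_nonpos_of_nonpos (not_lt.1 h) (not_lt.1 fun h' => h ((key j).2 h'))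
  have := (Finset.sum_eq_zero_iff_of_nonneg hnn).1 hsum j₀ (Finset.mem_univ _)
  exact (mul_pos hpos ((key j₀).1 hpos)).ne' this

lemma card_traces_le {ι J F : Type*} [Fintype J] [AddCommGroup F]
    [Module ℝ F] [FiniteDimensional ℝ F] (φ : J → F) {B : ι → J → Prop}
    (hB : ∀ w, ∃ l : F →ₗ[ℝ] ℝ, ∀ j, B w j ↔ 0 < l (φ j)) :
    (traces B).card ≤ (Fintype.card J + 1) ^ Module.finrank ℝ F := by
  classical
  refine (Finset.card_le_card_shatterer _).trans (Finset.card_shatterer_le_sum_vcDim.trans ?_)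
  refine (sum_choose_Iic_le _ _).trans (Nat.pow_le_pow_right (by omega) ?_)
  exact Finset.sup_le fun s hs => Shatters.card_le_finrank hB (Finset.mem_shatterer.1 hs)

/-! ### Labels of the points of a trace -/

lemma measurableSet_mem_traces {ι J Ω : Type*} [Fintype J] [Countable ι] [MeasurableSpace Ω]
    {B : Ω → ι → J → Prop} (hB : ∀ w j, MeasurableSet {ω | B ω w j}) (I : Finset J) :
    MeasurableSet {ω | I ∈ traces (B ω)} := by
  have : {ω | I ∈ traces (B ω)} = ⋃ w, ⋂ j, {ω | j ∈ I ↔ B ω w j} := by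
    ext ω; simp [mem_traces]
  rw [this]
  refine MeasurableSet.iUnion fun w => MeasurableSet.iInter fun j => ?_
  by_cases hj : j ∈ I
  · simpa [hj] using hB w j
  · simp only [hj, false_iff]
    exact (hB w j).compl

section

variable {d : ℕ} {D : Measure (Example d)} {η : E d → ℝ}

instance instIsProbabilityMeasureSampleLaw {n : ℕ} [IsProbabilityMeasure D] :
    IsProbabilityMeasure (sampleLaw D n) := by
  unfold sampleLaw; infer_instance

/-- Integration against `D`: draw the instance from the marginal, then the label `1` with
probability `η`. -/
lemma IsCondLabelProb.lintegral_mul [IsProbabilityMeasure D] (hη : IsCondLabelProb D η)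
    {φ : E d → ℝ≥0∞} (hφ : Measurable φ) (h : Fin 2 → ℝ≥0∞) :
    ∫⁻ z, φ z.1 * h z.2 ∂D =
      ∫⁻ x, φ x * (ENNReal.ofReal (η x) * h 1 + ENNReal.ofReal (1 - η x) * h 0) ∂D.fst := by
  have hm1 : Measurable fun x => ENNReal.ofReal (η x) := hη.measurable.ennreal_ofReal
  have hm0 : Measurable fun x => ENNReal.ofReal (1 - η x) :=
    (measurable_const.sub hη.measurable).ennreal_ofReal
  have hS : ∀ y : Fin 2, MeasurableSet (Prod.snd ⁻¹' {y} : Set (Example d)) := fun y =>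
    measurable_snd (measurableSet_singleton y)
  have hone : (D.restrict (Prod.snd ⁻¹' {1})).map Prod.fst =
      D.fst.withDensity fun x => ENNReal.ofReal (η x) := by
    ext A hA
    rw [Measure.map_apply measurable_fst hA, Measure.restrict_apply (measurable_fst hA),
      withDensity_apply _ hA, ← hη.apply_prod_one A hA]
    rfl
  have hzero : (D.restrict (Prod.snd ⁻¹' {0})).map Prod.fst =
      D.fst.withDensity fun x => ENNReal.ofReal (1 - η x) := by
    ext A hA
    rw [Measure.map_apply measurable_fst hA, Measure.restrict_apply (measurable_fst hA),
      withDensity_apply _ hA]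
    have h1 : D (Prod.fst ⁻¹' A ∩ Prod.snd ⁻¹' {0}) + D (A ×ˢ {1}) = D.fst A := by
      rw [Measure.fst_apply hA, ← measure_inter_add_sdiff (Prod.fst ⁻¹' A) (hS 0)]
      congr 2
      ext ⟨x, y⟩
      simp only [Set.mem_prod, Set.mem_singleton_iff, Set.mem_sdiff, Set.mem_preimage]
      refine and_congr_right fun _ => ?_
      fin_cases y <;> simp
    have h2 : ∫⁻ x in A, ENNReal.ofReal (1 - η x) ∂D.fst + D (A ×ˢ {1}) = D.fst A := by
      rw [hη.apply_prod_one A hA, ← lintegral_add_left hm0]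
      have : ∀ x, ENNReal.ofReal (1 - η x) + ENNReal.ofReal (η x) = 1 := fun x => by
        rw [← ENNReal.ofReal_add (by linarith [(hη.mem_Icc x).2]) (hη.mem_Icc x).1]
        simp
      simp [this]
    exact (ENNReal.add_left_inj (measure_ne_top D _)).1 (h1.trans h2.symm)
  have hc : (Prod.snd ⁻¹' {1} : Set (Example d))ᶜ = Prod.snd ⁻¹' {0} := by
    ext ⟨x, y⟩
    fin_cases y <;> simp
  have part : ∀ y : Fin 2, ∫⁻ z in Prod.snd ⁻¹' {y}, φ z.1 * h z.2 ∂D =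
      (∫⁻ x, φ x ∂(D.restrict (Prod.snd ⁻¹' {y})).map Prod.fst) * h y := fun y => by
    have hφ1 : Measurable fun z : Example d => φ z.1 := hφ.comp measurable_fst
    rw [lintegral_map hφ measurable_fst, ← lintegral_mul_const _ hφ1]
    refine setLIntegral_congr_fun (hS y) fun z hz => ?_
    rw [Set.mem_preimage, Set.mem_singleton_iff] at hz
    simp [hz]
  rw [← lintegral_add_compl _ (hS 1), hc, part, part, hone, hzero,
    lintegral_withDensity_eq_lintegral_mul _ hm1 hφ,
    lintegral_withDensity_eq_lintegral_mul _ hm0 hφ,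
    ← lintegral_mul_const _ (hm1.mul hφ), ← lintegral_mul_const _ (hm0.mul hφ),
    ← lintegral_add_left ((hm1.mul hφ).mul_const _)]
  refine lintegral_congr fun x => ?_
  simp only [Pi.mul_apply]
  ring

/-- A label-dependent weight with conditional mean at most `c` on `G` contributes a factor of at
most `c` for each sample point, even when the remaining integrand depends on all instances. -/
lemma lintegral_prod_weight_le [IsProbabilityMeasure D] (hη : IsCondLabelProb D η) {n : ℕ}
    {g : (Fin n → E d) → ℝ≥0∞} (hg : Measurable g) {G : Set (E d)} (hG : MeasurableSet G)
    {h : Fin 2 → ℝ≥0∞} {c : ℝ≥0∞}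
    (hc : ∀ x ∈ G, ENNReal.ofReal (η x) * h 1 + ENNReal.ofReal (1 - η x) * h 0 ≤ c)
    (I : Finset (Fin n)) :
    ∫⁻ S, g (fun i => (S i).1) * ∏ i ∈ I, G.indicator 1 (S i).1 * h (S i).2 ∂sampleLaw D n ≤
      c ^ I.card * ∫⁻ S, g (fun i => (S i).1) ∂sampleLaw D n := by
  have hgm : Measurable fun S : Sample d n => g fun i => (S i).1 :=
    hg.comp (measurable_pi_lambda _ fun i => (measurable_pi_apply i).fst)
  have hwm : ∀ i, Measurable fun S : Sample d n =>
      G.indicator (1 : E d → ℝ≥0∞) (S i).1 * h (S i).2 :=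
    fun i => ((measurable_one.indicator hG).comp (measurable_pi_apply i).fst).mul
      ((measurable_of_countable h).comp (measurable_pi_apply i).snd)
  have hprod : ∀ I : Finset (Fin n), Measurable fun S : Sample d n =>
      g (fun i => (S i).1) * ∏ i ∈ I, G.indicator 1 (S i).1 * h (S i).2 := fun I =>
    hgm.mul (Finset.measurable_fun_prod _ fun i _ => hwm i)
  induction I using Finset.induction_on with
  | empty => simp
  | insert j I hj ih =>
    rw [Finset.card_insert_of_notMem hj, pow_succ', mul_assoc]
    refine le_trans ?_ (mul_le_mul_right ih c)
    rw [← lintegral_const_mul _ (hprod I)]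
    -- It suffices to compare the integrals over the `j`-th example, the others being fixed.
    refine lintegral_le_of_lmarginal_le {j} (hprod _)
      ((hprod I).const_mul c) ?_
    intro S
    rw [lmarginal_singleton, lmarginal_singleton]
    have hg' : ∀ z : Example d, (fun i => (Function.update S j z i).1) =
        Function.update (fun i => (S i).1) j z.1 := fun z => by
      ext1 i
      by_cases hi : i = j
      · subst hi; simp
      · simp [hi]
    set q : ℝ≥0∞ := ∏ i ∈ I, G.indicator 1 (S i).1 * h (S i).2
    have hq : ∀ z : Example d, ∏ i ∈ I, G.indicator 1 (Function.update S j z i).1 *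
        h (Function.update S j z i).2 = q := fun z =>
      Finset.prod_congr rfl fun i hi => by
        rw [Function.update_of_ne (ne_of_mem_of_not_mem hi hj)]
    simp_rw [Finset.prod_insert hj, hq, hg', Function.update_self]
    have hφ : Measurable fun x : E d => g (Function.update (fun i => (S i).1) j x) :=
      hg.comp (measurable_update _)
    calc _ = ∫⁻ z : Example d, (g (Function.update (fun i => (S i).1) j z.1) * q *
              G.indicator 1 z.1) * h z.2 ∂D := by
          refine lintegral_congr fun z => ?_; ring
      _ = ∫⁻ x, (g (Function.update (fun i => (S i).1) j x) * q * G.indicator 1 x) *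
            (ENNReal.ofReal (η x) * h 1 + ENNReal.ofReal (1 - η x) * h 0) ∂D.fst :=
          hη.lintegral_mul ((hφ.mul_const q).mul (measurable_one.indicator hG)) h
      _ ≤ ∫⁻ x, c * (g (Function.update (fun i => (S i).1) j x) * q) ∂D.fst := by
          refine lintegral_mono fun x => ?_
          by_cases hx : x ∈ G
          · simp only [Set.indicator_of_mem hx, Pi.one_apply, mul_one]
            rw [mul_comm]
            exact mul_le_mul_left (hc x hx) _
          · simp [Set.indicator_of_notMem hx]
      _ = _ := by
          rw [Measure.fst, lintegral_map ((hφ.mul_const q).const_mul c) measurable_fst]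

/-- Union bound over the traces of size `k`, conditionally on the instances. -/
lemma sampleLaw_exists_trace_le [IsProbabilityMeasure D] (hη : IsCondLabelProb D η) {n : ℕ}
    {ι : Type*} [Countable ι] {B : (Fin n → E d) → ι → Fin n → Prop}
    (hB : ∀ w i, MeasurableSet {X | B X w i}) {k N : ℕ}
    (hN : ∀ X, ((traces (B X)).filter fun I => I.card = k).card ≤ N)
    {G : Set (E d)} (hG : MeasurableSet G) {h : Fin 2 → ℝ≥0∞} {c : ℝ≥0∞}
    (hc : ∀ x ∈ G, ENNReal.ofReal (η x) * h 1 + ENNReal.ofReal (1 - η x) * h 0 ≤ c) :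
    sampleLaw D n {S | ∃ I ∈ traces (B fun i => (S i).1), I.card = k ∧ (∀ i ∈ I, (S i).1 ∈ G) ∧
      1 ≤ ∏ i ∈ I, h (S i).2} ≤ N * c ^ k := by
  classical
  let T : Finset (Fin n) → Set (Fin n → E d) := fun I => {X | I ∈ traces (B X)}
  have hT : ∀ I, MeasurableSet (T I) := fun I => measurableSet_mem_traces hB I
  have hTm : ∀ I, Measurable ((T I).indicator (1 : (Fin n → E d) → ℝ≥0∞)) := fun I =>
    measurable_one.indicator (hT I)
  have hXm : Measurable fun S : Sample d n => fun i => (S i).1 :=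
    measurable_pi_lambda _ fun i => (measurable_pi_apply i).fst
  let f : Finset (Fin n) → Sample d n → ℝ≥0∞ := fun I S =>
    (T I).indicator 1 (fun i => (S i).1) * ∏ i ∈ I, G.indicator 1 (S i).1 * h (S i).2
  have hf : ∀ I, Measurable (f I) := fun I => ((hTm I).comp hXm).mul
    (Finset.measurable_fun_prod _ fun i _ =>
      ((measurable_one.indicator hG).comp (measurable_pi_apply i).fst).mul
        ((measurable_of_countable h).comp (measurable_pi_apply i).snd))
  have hsub : {S : Sample d n | ∃ I ∈ traces (B fun i => (S i).1), I.card = k ∧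
      (∀ i ∈ I, (S i).1 ∈ G) ∧ 1 ≤ ∏ i ∈ I, h (S i).2} ⊆
      {S | 1 ≤ ∑ I ∈ Finset.univ.powersetCard k, f I S} := by
    rintro S ⟨I, hI, hk, hIG, hh⟩
    refine le_trans ?_ (Finset.single_le_sum (f := fun I => f I S) (fun _ _ => zero_le)
      (Finset.mem_powersetCard.2 ⟨Finset.subset_univ I, hk⟩))
    have h1 : (T I).indicator (1 : (Fin n → E d) → ℝ≥0∞) (fun i => (S i).1) = 1 :=
      Set.indicator_of_mem (s := T I) hI _
    have h2 : ∏ i ∈ I, G.indicator (1 : E d → ℝ≥0∞) (S i).1 * h (S i).2 = ∏ i ∈ I, h (S i).2 :=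
      Finset.prod_congr rfl fun i hi => by rw [Set.indicator_of_mem (hIG i hi)]; simp
    simpa only [f, h1, h2, one_mul] using hh
  calc _ ≤ sampleLaw D n {S | 1 ≤ ∑ I ∈ Finset.univ.powersetCard k, f I S} := measure_mono hsub
    _ ≤ ∫⁻ S, ∑ I ∈ Finset.univ.powersetCard k, f I S ∂sampleLaw D n := by
        simpa using mul_meas_ge_le_lintegral (μ := sampleLaw D n)
          (Finset.measurable_fun_sum _ fun I _ => hf I) 1
    _ = ∑ I ∈ Finset.univ.powersetCard k, ∫⁻ S, f I S ∂sampleLaw D n :=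
        lintegral_finsetSum _ fun I _ => hf I
    _ ≤ ∑ I ∈ Finset.univ.powersetCard k,
          c ^ k * ∫⁻ S, (T I).indicator 1 (fun i => (S i).1) ∂sampleLaw D n := by
        refine Finset.sum_le_sum fun I hI => ?_
        rw [← (Finset.mem_powersetCard.1 hI).2]
        exact lintegral_prod_weight_le hη (hTm I) hG hc I
    _ = c ^ k * ∫⁻ S, ∑ I ∈ Finset.univ.powersetCard k,
          (T I).indicator 1 (fun i => (S i).1) ∂sampleLaw D n := by
        rw [← Finset.mul_sum]
        congr 1
        exact (lintegral_finsetSum _ fun I _ => (hTm I).comp hXm).symm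
    _ ≤ c ^ k * ∫⁻ _, N ∂sampleLaw D n := by
        refine mul_le_mul_right (lintegral_mono fun S => ?_) _
        have : ∑ I ∈ Finset.univ.powersetCard k,
            (T I).indicator (1 : (Fin n → E d) → ℝ≥0∞) (fun i => (S i).1) =
            (((traces (B fun i => (S i).1)).filter fun I => I.card = k).card : ℝ≥0∞) := by
          simp only [Set.indicator_apply, T, Set.mem_ofPred_eq, Pi.one_apply, Finset.sum_boole]
          congr 2
          ext I
          simp [Finset.mem_powersetCard, and_comm]
        rw [this]
        exact Nat.cast_le.2 (hN _)
    _ = N * c ^ k := by simp [mul_comm]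

end

/-! ### Relative deviations of empirical frequencies -/

section Symmetrization

/-- Chord bound for the convex function `m ↦ exp (t m)`. -/
lemma exp_mul_le_chord {m : ℝ} (h0 : 0 ≤ m) (h1 : m ≤ 1) (t : ℝ) :
    Real.exp (t * m) ≤ 1 + m * (Real.exp t - 1) := by
  have h := convexOn_exp.2 (Set.mem_univ (0 : ℝ)) (Set.mem_univ t) (sub_nonneg.2 h1) h0 (by ring)
  simp only [smul_eq_mul, mul_zero, zero_add, Real.exp_zero, mul_one] at h
  rw [mul_comm t m]
  linarith

/-- The factor `1 - 2 * t` leaves a random swap of a point with its ghost no exponential gain. -/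
lemma exp_swap_le {t : ℝ} (h0 : 0 ≤ t) (h1 : t ≤ 1 / 2) :
    Real.exp (t * (1 - 2 * t)) + Real.exp (-t) ≤ 2 := by
  have hs : 0 ≤ t * (1 - 2 * t) := mul_nonneg h0 (by linarith)
  have hs' : t * (1 - 2 * t) ≤ 1 := by nlinarith
  have e1 := (abs_le.1 (Real.abs_exp_sub_one_sub_id_le (x := t * (1 - 2 * t))
    (by rw [abs_of_nonneg hs]; exact hs'))).2
  have e2 := (abs_le.1 (Real.abs_exp_sub_one_sub_id_le (x := -t)
    (by rw [abs_neg, abs_of_nonneg h0]; linarith))).2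
  have hle : t * (1 - 2 * t) ≤ t := by nlinarith
  nlinarith [mul_le_mul hle hle hs h0]

open Classical in
/-- The exponential weight of a set `J` of points and ghost points: with parameter `t`, every ghost
point `(i, true)` of `J` counts `1 - 2 * t`, and every point `(i, false)` of `J` counts `-1`. -/
noncomputable def swapWeight {n : ℕ} (t : ℝ) (J : Finset (Fin n × Bool)) : ℝ :=
  ∏ i, Real.exp (t * ((1 - 2 * t) * (if (i, true) ∈ J then 1 else 0) -
    (if (i, false) ∈ J then 1 else 0)))

lemma swapWeight_pos {n : ℕ} (t : ℝ) (J : Finset (Fin n × Bool)) : 0 < swapWeight t J :=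
  Finset.prod_pos fun _ _ => Real.exp_pos _

/-- The swap, for all `i` with `ε i`, of the point `i` with its ghost. -/
def swapPerm {n : ℕ} (ε : Fin n → Bool) : Equiv.Perm (Fin n × Bool) :=
  Function.Involutive.toPerm (fun j => (j.1, xor j.2 (ε j.1))) fun j => by simp

lemma sum_swapWeight_le {n : ℕ} {t : ℝ} (h0 : 0 ≤ t) (h1 : t ≤ 1 / 2)
    (J : Finset (Fin n × Bool)) :
    ∑ ε : Fin n → Bool, swapWeight t ((swapPerm ε).finsetCongr J) ≤ 2 ^ n := by
  classical
  have hmem : ∀ (ε : Fin n → Bool) (i : Fin n) (b : Bool),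
      (i, b) ∈ (swapPerm ε).finsetCongr J ↔ (i, xor b (ε i)) ∈ J := fun ε i b => by
    simp only [Equiv.finsetCongr_apply, Finset.mem_map_equiv]
    rfl
  simp only [swapWeight, hmem]
  have := Finset.prod_univ_sum (fun _ : Fin n => (Finset.univ : Finset Bool)) fun i b =>
    Real.exp (t * ((1 - 2 * t) * (if (i, xor true b) ∈ J then 1 else 0) -
      (if (i, xor false b) ∈ J then 1 else 0)))
  rw [Fintype.piFinset_univ] at this
  rw [← this]
  calc _ ≤ ∏ _i : Fin n, (2 : ℝ) := by
        refine Finset.prod_le_prod (fun i _ => Finset.sum_nonneg fun b _ => (Real.exp_pos _).le)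
          fun i _ => ?_
        have e := exp_swap_le h0 h1
        have e' : Real.exp (t * (1 - 2 * t - 1)) ≤ 1 := Real.exp_le_one_iff.2 (by nlinarith)
        rw [Fintype.sum_bool]
        by_cases hu : (i, true) ∈ J <;> by_cases hv : (i, false) ∈ J <;>
          simp only [hu, hv, Bool.xor_false, Bool.xor_true, Bool.not_true, Bool.not_false, if_true,
            if_false, mul_one, mul_zero, sub_zero, zero_sub, sub_self, Real.exp_zero, mul_neg,
            zero_sub] <;> linarith
    _ = 2 ^ n := by simp

variable {Z ι : Type*} [MeasurableSpace Z] {ν : Measure Z}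

lemma lintegral_exp_indicator_ge [IsProbabilityMeasure ν] {A : Set Z} (hA : MeasurableSet A)
    {s : ℝ} (hs : 0 ≤ s) :
    ENNReal.ofReal (Real.exp (s * ν.real A)) ≤
      ∫⁻ z, ENNReal.ofReal (Real.exp (s * A.indicator 1 z)) ∂ν := by
  have h1 : 0 ≤ Real.exp s - 1 := by linarith [Real.one_le_exp hs]
  have : ∀ z, ENNReal.ofReal (Real.exp (s * A.indicator 1 z)) =
      1 + A.indicator (fun _ => ENNReal.ofReal (Real.exp s - 1)) z := fun z => by
    by_cases hz : z ∈ A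
    · simp only [Set.indicator_of_mem hz, Pi.one_apply, mul_one]
      rw [← ENNReal.ofReal_one, ← ENNReal.ofReal_add zero_le_one h1]
      congr 1; ring
    · simp [Set.indicator_of_notMem hz]
  simp_rw [this]
  rw [lintegral_add_left measurable_const, lintegral_indicator_const hA]
  simp only [lintegral_const, measure_univ, mul_one]
  rw [← ofReal_measureReal, ← ENNReal.ofReal_one, ← ENNReal.ofReal_mul h1,
    ← ENNReal.ofReal_add zero_le_one (mul_nonneg h1 measureReal_nonneg)]
  refine ENNReal.ofReal_le_ofReal ?_
  rw [mul_comm (Real.exp s - 1)]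
  exact exp_mul_le_chord measureReal_nonneg measureReal_le_one s

/-- Membership of a point, or of its ghost, in the sets of a family. -/
def pairTrace {n : ℕ} (A : ι → Set Z) (z : Fin n → Z × Z) (w : ι) (j : Fin n × Bool) : Prop :=
  (if j.2 then (z j.1).2 else (z j.1).1) ∈ A w

/-- Symmetrization: over a double sample, the total weight of the traces has mean at most the
number of traces, since the law is invariant under swaps. -/
lemma lintegral_sum_swapWeight_le [IsProbabilityMeasure ν] [Countable ι] {n : ℕ} {A : ι → Set Z}
    (hA : ∀ w, MeasurableSet (A w)) {N : ℕ}
    (hN : ∀ z : Fin n → Z × Z, (traces (pairTrace A z)).card ≤ N) {t : ℝ} (h0 : 0 ≤ t)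
    (h1 : t ≤ 1 / 2) :
    Measurable (fun z : Fin n → Z × Z =>
      ∑ J ∈ traces (pairTrace A z), ENNReal.ofReal (swapWeight t J)) ∧
    ∫⁻ z, ∑ J ∈ traces (pairTrace A z), ENNReal.ofReal (swapWeight t J)
      ∂Measure.pi (fun _ : Fin n => ν.prod ν) ≤ N := by
  classical
  set P := Measure.pi (fun _ : Fin n => ν.prod ν)
  set Φ : (Fin n → Z × Z) → ℝ≥0∞ := fun z =>
    ∑ J ∈ traces (pairTrace A z), ENNReal.ofReal (swapWeight t J) with hΦ
  have hB : ∀ w j, MeasurableSet {z : Fin n → Z × Z | pairTrace A z w j} := by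
    rintro w ⟨i, b⟩
    cases b
    · exact (measurable_pi_apply i).fst (hA w)
    · exact (measurable_pi_apply i).snd (hA w)
  have hΦm : Measurable Φ := by
    have : Φ = fun z => ∑ J, Set.indicator {z | J ∈ traces (pairTrace A z)}
        (fun _ => ENNReal.ofReal (swapWeight t J)) z := by
      ext z
      simp [hΦ, Set.indicator_apply, Finset.sum_ite_mem]
    rw [this]
    exact Finset.measurable_fun_sum _ fun J _ =>
      measurable_const.indicator (measurableSet_mem_traces hB J)
  refine ⟨hΦm, ?_⟩
  let s : (Fin n → Bool) → (Fin n → Z × Z) → Fin n → Z × Z := fun ε z i =>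
    (if ε i then Prod.swap else id) (z i)
  have hs : ∀ ε, MeasurePreserving (s ε) P P := fun ε => by
    refine measurePreserving_pi _ _ fun i => ?_
    cases ε i
    · simpa using MeasurePreserving.id _
    · simpa using Measure.measurePreserving_swap (μ := ν) (ν := ν)
  have hpair : ∀ ε z w j, pairTrace A (s ε z) w j ↔ pairTrace A z w (swapPerm ε j) := by
    rintro ε z w ⟨i, b⟩
    change (if b then (s ε z i).2 else (s ε z i).1) ∈ A w ↔
      (if xor b (ε i) then (z i).2 else (z i).1) ∈ A w
    cases b <;> cases h : ε i <;> simp [s, h]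
  have hΦs : ∀ ε z, Φ (s ε z) = ∑ J ∈ traces (pairTrace A z),
      ENNReal.ofReal (swapWeight t ((swapPerm ε).finsetCongr J)) := fun ε z => by
    symm
    refine Finset.sum_equiv (swapPerm ε).finsetCongr (fun J => ?_) fun J _ => rfl
    simp only [mem_traces, hpair, Equiv.finsetCongr_apply, Finset.mem_map_equiv]
    refine exists_congr fun w => ?_
    refine (swapPerm ε).forall_congr_left.trans (forall_congr' fun j => ?_)
    rfl
  have hsum : ∀ z, ∑ ε, Φ (s ε z) ≤ 2 ^ n * N := fun z => by
    simp_rw [hΦs]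
    rw [Finset.sum_comm]
    calc _ ≤ ∑ _J ∈ traces (pairTrace A z), (2 : ℝ≥0∞) ^ n := by
          refine Finset.sum_le_sum fun J _ => ?_
          rw [← ENNReal.ofReal_sum_of_nonneg fun ε _ => (swapWeight_pos _ _).le]
          refine (ENNReal.ofReal_le_ofReal (sum_swapWeight_le h0 h1 J)).trans_eq ?_
          rw [ENNReal.ofReal_pow zero_le_two, ENNReal.ofReal_ofNat]
      _ ≤ 2 ^ n * N := by
          rw [Finset.sum_const, nsmul_eq_mul, mul_comm]
          exact mul_le_mul_right (Nat.cast_le.2 (hN z)) _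
  have h2 : (2 : ℝ≥0∞) ^ n * ∫⁻ z, Φ z ∂P ≤ 2 ^ n * N :=
    calc _ = ∑ ε : Fin n → Bool, ∫⁻ z, Φ z ∂P := by simp
      _ = ∑ ε : Fin n → Bool, ∫⁻ z, Φ (s ε z) ∂P :=
          Finset.sum_congr rfl fun ε _ => ((hs ε).lintegral_comp hΦm).symm
      _ = ∫⁻ z, ∑ ε : Fin n → Bool, Φ (s ε z) ∂P :=
          (lintegral_finsetSum _ fun ε _ => hΦm.comp (hs ε).measurable).symm
      _ ≤ ∫⁻ _, 2 ^ n * N ∂P := lintegral_mono hsum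
      _ = 2 ^ n * N := by simp
  exact (ENNReal.mul_le_mul_iff_right (by simp) (by simp)).1 h2

open Classical in
/-- Relative uniform deviations, lower tail: it is unlikely that some set of a family with few
traces has large probability and contains fewer than `k` sample points. -/
lemma pi_exists_sparse_le [IsProbabilityMeasure ν] [Countable ι] {n : ℕ} {A : ι → Set Z}
    (hA : ∀ w, MeasurableSet (A w)) {N : ℕ}
    (hN : ∀ z : Fin n → Z × Z, (traces (pairTrace A z)).card ≤ N) {t : ℝ} (h0 : 0 ≤ t)
    (h1 : t ≤ 1 / 2) (K : ℝ) (k : ℕ) :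
    Measure.pi (fun _ : Fin n => ν)
      {S | ∃ w, K ≤ n * ν.real (A w) ∧ (Finset.univ.filter fun i => S i ∈ A w).card < k} ≤
      ENNReal.ofReal (N * Real.exp (-(t * ((1 - 2 * t) * K - k)))) := by
  obtain ⟨hΦm, hΦ⟩ := lintegral_sum_swapWeight_le (ν := ν) hA hN h0 h1
  set Φ : (Fin n → Z × Z) → ℝ≥0∞ := fun z =>
    ∑ J ∈ traces (pairTrace A z), ENNReal.ofReal (swapWeight t J)
  set P := Measure.pi fun _ : Fin n => ν
  set e := MeasurableEquiv.arrowProdEquivProdArrow Z Z (Fin n)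
  set b := t * ((1 - 2 * t) * K - k)
  have hmp : MeasurePreserving e (Measure.pi fun _ : Fin n => ν.prod ν) (P.prod P) :=
    measurePreserving_arrowProdEquivProdArrow Z Z (Fin n) _ _
  have hΨm : Measurable fun S => ∫⁻ S', Φ (e.symm (S, S')) ∂P :=
    (hΦm.comp e.symm.measurable).lintegral_prod_right'
  have ha : 0 ≤ t * (1 - 2 * t) := mul_nonneg h0 (by linarith)
  have hsub : {S : Fin n → Z | ∃ w, K ≤ n * ν.real (A w) ∧
      (Finset.univ.filter fun i => S i ∈ A w).card < k} ⊆
      {S | ENNReal.ofReal (Real.exp b) ≤ ∫⁻ S', Φ (e.symm (S, S')) ∂P} := by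
    rintro S ⟨w, hK, hk⟩
    -- The trace of the single set `A w` already carries enough weight on average over the ghosts.
    have hcard : ∑ i, (A w).indicator (1 : Z → ℝ) (S i) ≤ k := by
      have : ∑ i, (A w).indicator (1 : Z → ℝ) (S i) =
          ((Finset.univ.filter fun i => S i ∈ A w).card : ℝ) := by
        simp [Set.indicator_apply]
      rw [this]
      exact_mod_cast hk.le
    have hpoint : ∀ S', ENNReal.ofReal (Real.exp (-(t * k))) *
        ∏ i, ENNReal.ofReal (Real.exp (t * (1 - 2 * t) * (A w).indicator 1 (S' i))) ≤
        Φ (e.symm (S, S')) := fun S' => by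
      let J : Finset (Fin n × Bool) := Finset.univ.filter (pairTrace A (e.symm (S, S')) w)
      have hJ : J ∈ traces (pairTrace A (e.symm (S, S'))) := mem_traces.2 ⟨w, fun j => by simp [J]⟩
      refine le_trans ?_ (Finset.single_le_sum
        (f := fun J => ENNReal.ofReal (swapWeight t J)) (fun _ _ => zero_le) hJ)
      rw [← ENNReal.ofReal_prod_of_nonneg fun _ _ => (Real.exp_pos _).le,
        ← ENNReal.ofReal_mul (Real.exp_pos _).le, ← Real.exp_sum, ← Real.exp_add]
      refine ENNReal.ofReal_le_ofReal ?_
      rw [swapWeight, ← Real.exp_sum, Real.exp_le_exp, ← Finset.mul_sum, ← Finset.mul_sum,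
        Finset.sum_sub_distrib, ← Finset.mul_sum]
      have m1 : ∀ i : Fin n, ((i, true) ∈ J ↔ S' i ∈ A w) := fun i => by
        simp [J, pairTrace, e]; rfl
      have m2 : ∀ i : Fin n, ((i, false) ∈ J ↔ S i ∈ A w) := fun i => by
        simp [J, pairTrace, e]; rfl
      simp only [m1, m2]
      simp only [Set.indicator_apply, Pi.one_apply] at hcard ⊢
      nlinarith [mul_le_mul_of_nonneg_left hcard h0]
    have hexp : Measurable fun z => ENNReal.ofReal
        (Real.exp (t * (1 - 2 * t) * (A w).indicator 1 z)) :=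
      (Real.measurable_exp.comp ((measurable_one.indicator (hA w)).const_mul _)).ennreal_ofReal
    calc ENNReal.ofReal (Real.exp b)
        ≤ ENNReal.ofReal (Real.exp (-(t * k))) *
            ∏ _i : Fin n, ENNReal.ofReal (Real.exp (t * (1 - 2 * t) * ν.real (A w))) := by
          rw [← ENNReal.ofReal_prod_of_nonneg fun _ _ => (Real.exp_pos _).le,
            ← ENNReal.ofReal_mul (Real.exp_pos _).le, ← Real.exp_sum, ← Real.exp_add]
          refine ENNReal.ofReal_le_ofReal (Real.exp_le_exp.2 ?_)
          simp only [Finset.sum_const, Finset.card_univ, Fintype.card_fin, nsmul_eq_mul]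
          have := mul_le_mul_of_nonneg_left hK ha
          simp only [b]
          linarith
      _ ≤ ENNReal.ofReal (Real.exp (-(t * k))) * ∏ _i : Fin n,
            ∫⁻ z, ENNReal.ofReal (Real.exp (t * (1 - 2 * t) * (A w).indicator 1 z)) ∂ν := by
          gcongr
          exact lintegral_exp_indicator_ge (hA w) ha
      _ = ∫⁻ S', ENNReal.ofReal (Real.exp (-(t * k))) *
            ∏ i, ENNReal.ofReal (Real.exp (t * (1 - 2 * t) * (A w).indicator 1 (S' i))) ∂P := by
          have hprod : Measurable fun S' : Fin n → Z =>
              ∏ i, ENNReal.ofReal (Real.exp (t * (1 - 2 * t) * (A w).indicator 1 (S' i))) :=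
            Finset.measurable_fun_prod _ fun i _ => hexp.comp (measurable_pi_apply i)
          rw [lintegral_const_mul _ hprod]
          congr 1
          rw [ProbabilityTheory.lintegral_prod_eq_prod_lintegral_of_indepFun Finset.univ _
            (ProbabilityTheory.iIndepFun_pi fun _ => hexp.aemeasurable)
            fun i => hexp.comp (measurable_pi_apply i)]
          exact Finset.prod_congr rfl fun i _ =>
            ((measurePreserving_eval (fun _ : Fin n => ν) i).lintegral_comp hexp).symm
      _ ≤ _ := lintegral_mono hpoint
  have hint : ENNReal.ofReal (Real.exp b) * P {S | ENNReal.ofReal (Real.exp b) ≤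
      ∫⁻ S', Φ (e.symm (S, S')) ∂P} ≤ N := by
    refine (mul_meas_ge_le_lintegral hΨm _).trans (le_trans (le_of_eq ?_) hΦ)
    refine (lintegral_prod _ (hΦm.comp e.symm.measurable).aemeasurable).symm.trans ?_
    rw [← hmp.lintegral_comp (hΦm.comp e.symm.measurable)]
    simp
  calc _ ≤ P {S | ENNReal.ofReal (Real.exp b) ≤ ∫⁻ S', Φ (e.symm (S, S')) ∂P} := measure_mono hsub
    _ = ENNReal.ofReal (Real.exp (-b)) * (ENNReal.ofReal (Real.exp b) *
          P {S | ENNReal.ofReal (Real.exp b) ≤ ∫⁻ S', Φ (e.symm (S, S')) ∂P}) := by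
        rw [← mul_assoc, ← ENNReal.ofReal_mul (Real.exp_pos _).le, ← Real.exp_add]
        simp
    _ ≤ ENNReal.ofReal (Real.exp (-b)) * N := mul_le_mul_right hint _
    _ = _ := by
        rw [mul_comm (N : ℝ), ENNReal.ofReal_mul (Real.exp_pos _).le, ENNReal.ofReal_natCast]

end Symmetrization

/-! ### Neighborhoods as traces of countable families -/

section Geometry

variable {d n : ℕ}

/-- The feature space in which balls, with ties on their spheres broken by an index, become
half-spaces: coordinates `x`, `‖x‖ ^ 2`, the index, and `1`. -/
abbrev Feature (d : ℕ) : Type := E d × ℝ × ℝ × ℝ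

lemma finrank_feature (d : ℕ) : Module.finrank ℝ (Feature d) = d + 3 := by
  simp [Feature, Module.finrank_prod]

/-- A countable family of balls, with centers in a dense sequence and rational radii. A radius
that is not positive gives the empty set. -/
def ballFamily (d : ℕ) (w : ℕ × ℚ) : Set (E d) :=
  Metric.ball (TopologicalSpace.denseSeq (E d) w.1) w.2

lemma exists_linear_ballFamily (w : ℕ × ℚ) :
    ∃ l : Feature d →ₗ[ℝ] ℝ, ∀ x, x ∈ ballFamily d w ↔ 0 < l (x, ‖x‖ ^ 2, 0, 1) := by
  set q := TopologicalSpace.denseSeq (E d) w.1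
  rcases le_or_gt (w.2 : ℝ) 0 with hw | hw
  · refine ⟨0, fun x => ?_⟩
    simp [ballFamily, Metric.ball_eq_empty.2 hw]
  · refine ⟨((2 : ℝ) • (innerₛₗ ℝ q)).coprod ((-LinearMap.id).coprod
      ((0 : ℝ →ₗ[ℝ] ℝ).coprod (((w.2 : ℝ) ^ 2 - ‖q‖ ^ 2) • LinearMap.id))), fun x => ?_⟩
    have h := norm_sub_sq_real x q
    rw [real_inner_comm] at h
    rw [ballFamily, Metric.mem_ball, dist_eq_norm, ← sq_lt_sq₀ (norm_nonneg _) hw.le, h]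
    simp only [LinearMap.coprod_apply, LinearMap.smul_apply, innerₛₗ_apply_apply, smul_eq_mul,
      LinearMap.neg_apply, LinearMap.id_apply, LinearMap.zero_apply, mul_one]
    constructor <;> intro h' <;> linarith

lemma card_traces_ballFamily_le {Z : Type*} (z : Fin n → (E d × Z) × (E d × Z)) :
    (traces (pairTrace (fun w => Prod.fst ⁻¹' ballFamily d w) z)).card ≤
      (2 * n + 1) ^ (d + 3) := by
  have := card_traces_le (B := pairTrace (fun w => Prod.fst ⁻¹' ballFamily d w) z)
    (fun j => (((if j.2 then (z j.1).2.1 else (z j.1).1.1),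
      ‖if j.2 then (z j.1).2.1 else (z j.1).1.1‖ ^ 2, 0, 1) : Feature d)) fun w => by
    obtain ⟨l, hl⟩ := exists_linear_ballFamily (d := d) w
    refine ⟨l, ?_⟩
    rintro ⟨i, b⟩
    rw [← hl]
    cases b <;> rfl
  rwa [finrank_feature, Fintype.card_prod, Fintype.card_fin, Fintype.card_bool,
    mul_comm n 2] at this

/-- On a finite sample, a closed ball can be enlarged to a ball of the countable family without
taking in further sample points. -/
lemma exists_closedBall_subset_ballFamily (X : Fin n → E d) (x : E d) (R : ℝ) :
    ∃ w, Metric.closedBall x R ⊆ ballFamily d w ∧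
      ∀ i, X i ∈ ballFamily d w → X i ∈ Metric.closedBall x R := by
  obtain ⟨e, he, hX⟩ : ∃ e : ℝ, 0 < e ∧ ∀ i, R < dist (X i) x → R + e ≤ dist (X i) x := by
    have : ∀ᶠ e in 𝓝[>] (0 : ℝ), ∀ i, R < dist (X i) x → R + e ≤ dist (X i) x := by
      refine eventually_all.2 fun i => ?_
      by_cases h : R < dist (X i) x
      · filter_upwards [Ioc_mem_nhdsGT (sub_pos.2 h)] with e he _
        linarith [he.2]
      · exact Eventually.of_forall fun e h' => absurd h' h
    obtain ⟨e, h1, h2⟩ := (this.and self_mem_nhdsWithin).exists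
    exact ⟨e, h2, h1⟩
  obtain ⟨m, hm⟩ := (TopologicalSpace.denseRange_denseSeq (E d)).exists_dist_lt x
    (show (0 : ℝ) < e / 3 by positivity)
  obtain ⟨ρ, h1, h2⟩ := exists_rat_btwn (show R + e / 3 < R + 2 * e / 3 by linarith)
  refine ⟨(m, ρ), fun y hy => ?_, fun i hi => ?_⟩
  · rw [ballFamily, Metric.mem_ball]
    rw [Metric.mem_closedBall] at hy
    linarith [dist_triangle y x (TopologicalSpace.denseSeq (E d) m)]
  · rw [ballFamily, Metric.mem_ball] at hi
    rw [Metric.mem_closedBall]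
    by_contra! h
    rw [dist_comm] at hm
    simp only at hi
    linarith [hX i h, dist_triangle (X i) (TopologicalSpace.denseSeq (E d) m) x]

/-- A countable family of balls, perturbed so as to break ties in favor of the smaller index: the
parameters `(q, c, ε)` stand for the points `x i` with `‖x i‖ ^ 2 - 2 ⟪q, x i⟫ + ε * i < c`. -/
def tieBall (X : Fin n → E d) (w : ℕ) (i : Fin n) : Prop :=
  let q := TopologicalSpace.denseSeq (E d × ℝ × ℝ) w
  ‖X i‖ ^ 2 - 2 * inner ℝ q.1 (X i) + q.2.2 * (i : ℕ) < q.2.1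

lemma measurableSet_tieBall (w : ℕ) (i : Fin n) :
    MeasurableSet {X : Fin n → E d | tieBall X w i} :=
  (isOpen_lt (by fun_prop) continuous_const).measurableSet

lemma card_traces_tieBall_le (X : Fin n → E d) :
    (traces (tieBall X)).card ≤ (n + 1) ^ (d + 3) := by
  have := card_traces_le (B := tieBall X)
    (fun i => ((X i, ‖X i‖ ^ 2, ((i : ℕ) : ℝ), 1) : Feature d)) fun w => by
    set q := TopologicalSpace.denseSeq (E d × ℝ × ℝ) w with hq
    refine ⟨((2 : ℝ) • (innerₛₗ ℝ q.1)).coprod ((-LinearMap.id).coprod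
      (((-q.2.2) • LinearMap.id).coprod (q.2.1 • LinearMap.id))), fun i => ?_⟩
    simp only [tieBall, ← hq, LinearMap.coprod_apply, LinearMap.smul_apply, innerₛₗ_apply_apply,
      smul_eq_mul, LinearMap.neg_apply, LinearMap.id_apply, mul_one]
    constructor <;> intro h' <;> linarith
  rwa [finrank_feature, Fintype.card_fin] at this

/-- The indices of the `k` nearest neighbors. -/
noncomputable def nnSet (k : ℕ) (S : Sample d n) (x : E d) : Finset (Fin n) :=
  (Finset.univ.filter fun i : Fin n => i.val < k).map (nnIndex S x).toEmbedding

lemma card_nnSet {k : ℕ} (hk : k ≤ n) (S : Sample d n) (x : E d) : (nnSet k S x).card = k := by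
  rw [nnSet, Finset.card_map, Fin.card_filter_val_lt, min_eq_right hk]

lemma sum_nnSet (k : ℕ) (S : Sample d n) (x : E d) (f : Fin n → ℝ) :
    ∑ i ∈ nnSet k S x, f i = ∑ i ∈ Finset.univ.filter (fun i : Fin n => i.val < k),
      f (nnIndex S x i) := by
  simp [nnSet]

lemma mem_nnSet {k : ℕ} {S : Sample d n} {x : E d} {i : Fin n} :
    i ∈ nnSet k S x ↔ ((nnIndex S x).symm i : ℕ) < k := by
  simp [nnSet, Finset.mem_map_equiv]

/-- Members of the `k`-nearest-neighbor set precede non-members in the lexicographic order of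
distance and index. -/
lemma lex_of_mem_nnSet {k : ℕ} {S : Sample d n} {x : E d} {i j : Fin n} (hi : i ∈ nnSet k S x)
    (hj : j ∉ nnSet k S x) :
    dist x (S i).1 < dist x (S j).1 ∨ dist x (S i).1 = dist x (S j).1 ∧ i < j := by
  rw [mem_nnSet] at hi hj
  have hlt : (nnIndex S x).symm i < (nnIndex S x).symm j := by
    rw [Fin.lt_def]; omega
  obtain ⟨hmono, htie⟩ := (Tuple.eq_sort_iff (f := fun i => dist x (S i).1)
    (σ := nnIndex S x)).1 rfl
  have h1 : dist x (S i).1 ≤ dist x (S j).1 := by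
    simpa using hmono hlt.le
  rcases h1.lt_or_eq with h | h
  · exact Or.inl h
  · refine Or.inr ⟨h, ?_⟩
    have := htie _ _ hlt (by simpa using h)
    simpa using this

/-- The nearest neighbors form a trace of the countable family of perturbed balls: separate them by
adding to the squared distance a small multiple of the index, then perturb the parameters. -/
lemma nnSet_mem_traces (k : ℕ) (S : Sample d n) (x : E d) :
    nnSet k S x ∈ traces (tieBall fun i => (S i).1) := by
  set I := nnSet k S x
  let X : Fin n → E d := fun i => (S i).1
  let v : ℝ → Fin n → ℝ := fun ε i => ‖X i‖ ^ 2 - 2 * inner ℝ x (X i) + ε * (i : ℕ)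
  have hv0 : ∀ i, v 0 i = dist x (X i) ^ 2 - ‖x‖ ^ 2 := fun i => by
    simp only [v, dist_eq_norm, norm_sub_sq_real]; ring
  have hev : ∀ᶠ ε in 𝓝[>] (0 : ℝ), ∀ i j, i ∈ I → j ∉ I → v ε i < v ε j := by
    refine eventually_all.2 fun i => eventually_all.2 fun j => ?_
    by_cases hi : i ∈ I
    swap; · exact Eventually.of_forall fun _ h => absurd h hi
    by_cases hj : j ∈ I
    · exact Eventually.of_forall fun _ _ h => absurd hj h
    rcases lex_of_mem_nnSet hi hj with h | ⟨h, hij⟩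
    · have h0 : v 0 i < v 0 j := by
        rw [hv0, hv0]
        have := pow_lt_pow_left₀ h dist_nonneg two_ne_zero
        simpa [X] using this
      have hc : ∀ i, Continuous fun ε => v ε i := fun i => by fun_prop
      exact (((hc i).continuousAt.eventually_lt (hc j).continuousAt h0).filter_mono
        nhdsWithin_le_nhds).mono fun ε hε _ _ => hε
    · filter_upwards [self_mem_nhdsWithin] with ε hε _ _
      have h0 : v 0 i = v 0 j := by rw [hv0, hv0]; simp [X, h]
      have hij' : ((i : ℕ) : ℝ) < (j : ℕ) := by exact_mod_cast hij
      have := mul_lt_mul_of_pos_left hij' (Set.mem_Ioi.1 hε)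
      simp only [v, zero_mul, add_zero] at h0 ⊢
      linarith
  obtain ⟨ε, hε⟩ := hev.exists
  obtain ⟨c, hcI, hcI'⟩ : ∃ c, (∀ i ∈ I, v ε i < c) ∧ ∀ j ∉ I, c < v ε j := by
    obtain ⟨c, h1, h2⟩ := Order.exists_between_finsets (I.image (v ε)) (Iᶜ.image (v ε)) (by
      simp only [Finset.mem_image, Finset.mem_compl]
      rintro _ ⟨i, hi, rfl⟩ _ ⟨j, hj, rfl⟩
      exact hε i j hi hj)
    exact ⟨c, fun i hi => h1 _ (Finset.mem_image_of_mem _ hi), fun j hj =>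
      h2 _ (Finset.mem_image_of_mem _ (Finset.mem_compl.2 hj))⟩
  let U : Set (E d × ℝ × ℝ) := {q | ∀ i, (i ∈ I →
      ‖X i‖ ^ 2 - 2 * inner ℝ q.1 (X i) + q.2.2 * (i : ℕ) < q.2.1) ∧
    (i ∉ I → q.2.1 < ‖X i‖ ^ 2 - 2 * inner ℝ q.1 (X i) + q.2.2 * (i : ℕ))}
  have hU : IsOpen U := by
    simp only [U, Set.ofPred_forall, Set.ofPred_and]
    refine isOpen_iInter_of_finite fun i => IsOpen.inter ?_ ?_
    · exact isOpen_iInter_of_finite fun _ => isOpen_lt (by fun_prop) (by fun_prop)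
    · exact isOpen_iInter_of_finite fun _ => isOpen_lt (by fun_prop) (by fun_prop)
  obtain ⟨w, hw⟩ := (TopologicalSpace.denseRange_denseSeq (E d × ℝ × ℝ)).exists_mem_open hU
    ⟨(x, c, ε), fun i => ⟨fun hi => hcI i hi, fun hi => hcI' i hi⟩⟩
  refine mem_traces.2 ⟨w, fun i => ⟨fun hi => (hw i).1 hi, fun hi => ?_⟩⟩
  by_contra h
  exact lt_asymm hi ((hw i).2 h)

open Classical in
/-- If a closed ball around `x` contains `k` sample points, it contains the `k` nearest ones. -/
lemma dist_le_of_mem_nnSet {k : ℕ} {S : Sample d n} {x : E d} {R : ℝ}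
    (hk : k ≤ (Finset.univ.filter fun i => (S i).1 ∈ Metric.closedBall x R).card) {i : Fin n}
    (hi : i ∈ nnSet k S x) : dist (S i).1 x ≤ R := by
  by_contra! hR
  have hsub : (Finset.univ.filter fun i => (S i).1 ∈ Metric.closedBall x R) ⊆
      (nnSet k S x).erase i := by
    intro j hj
    simp only [Finset.mem_filter, Finset.mem_univ, true_and, Metric.mem_closedBall] at hj
    refine Finset.mem_erase.2 ⟨fun h => ?_, ?_⟩
    · subst h; exact absurd hj (not_le.2 hR)
    · by_contra hj'
      have := lex_of_mem_nnSet hi hj'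
      rw [dist_comm x, dist_comm x] at this
      rcases this with h | ⟨h, -⟩ <;> linarith
  have h1 := Finset.card_le_card hsub
  have h2 := Finset.card_erase_lt_of_mem hi
  have h3 : (nnSet k S x).card ≤ k := by
    rw [nnSet, Finset.card_map, Fin.card_filter_val_lt]; exact min_le_right _ _
  omega

end Geometry

/-! ### From samples to robustness and astuteness -/

section Deterministic

variable {d n k : ℕ} {𝒳 : Set (E d)} {D : Measure (Example d)} {η : E d → ℝ} {r Δ p δ : ℝ}

lemma le_measure_closedBall_probRadius {μ : Measure (E d)} [IsFiniteMeasure μ] {x : E d}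
    (h : probRadius μ p x ≠ ∞) :
    ENNReal.ofReal p ≤ μ (Metric.closedBall x (probRadius μ p x).toReal) := by
  set R := (probRadius μ p x).toReal
  have hball : Metric.closedBall x R = ⋂ s > R, Metric.closedBall x s := by
    ext y
    simp only [Set.mem_iInter, Metric.mem_closedBall]
    exact ⟨fun h s hs => h.trans (le_of_lt hs), fun h => le_of_forall_gt_imp_ge_of_dense h⟩
  rw [hball]
  refine ge_of_tendsto (tendsto_measure_biInter_gt
    (fun s _ => Metric.isClosed_closedBall.measurableSet.nullMeasurableSet)
    (fun i j _ hij => Metric.closedBall_subset_closedBall hij)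
    ⟨R + 1, by simp, measure_ne_top _ _⟩) ?_
  filter_upwards [self_mem_nhdsWithin] with s hs
  have hs0 : 0 ≤ s := ENNReal.toReal_nonneg.trans (le_of_lt hs)
  have hlt : probRadius μ p x < ENNReal.ofReal s := by
    rw [ENNReal.lt_ofReal_iff_toReal_lt h]; exact hs
  obtain ⟨t, ht, hts⟩ := sInf_lt_iff.1 hlt
  refine le_trans ht (measure_mono fun y hy => ?_)
  rw [Metric.mem_closedBall, ← edist_le_ofReal hs0]
  exact le_trans hy hts.le

/-- The label sum of the `k` nearest neighbors of `x`. -/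
noncomputable def labelSum (k : ℕ) (S : Sample d n) (x : E d) : ℝ :=
  ∑ i ∈ nnSet k S x, (((S i).2 : ℕ) : ℝ)

lemma knn_eq_one {S : Sample d n} {x : E d} (h : (k : ℝ) / 2 ≤ labelSum k S x) :
    knn k S x = 1 := by
  rw [labelSum, sum_nnSet] at h
  exact if_pos h

lemma knn_eq_zero {S : Sample d n} {x : E d} (h : labelSum k S x < (k : ℝ) / 2) :
    knn k S x = 0 := by
  rw [labelSum, sum_nnSet] at h
  exact if_neg (not_le.2 h)

open Classical in
/-- The sample points lie in `𝒳`, and every closed ball of probability at least `p` contains `k` of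
them. -/
structure IsTypical (𝒳 : Set (E d)) (D : Measure (Example d)) (k : ℕ) (p : ℝ)
    (S : Sample d n) : Prop where
  mem : ∀ i, (S i).1 ∈ 𝒳
  le_card : ∀ x R, ENNReal.ofReal p ≤ D.fst (Metric.closedBall x R) →
    k ≤ (Finset.univ.filter fun i => (S i).1 ∈ Metric.closedBall x R).card

/-- The `k` nearest neighbors of any point vote for the label `1` whenever all of them have
`η > 1 / 2 + Δ`. -/
def VotesOne (η : E d → ℝ) (k : ℕ) (Δ : ℝ) (S : Sample d n) : Prop :=
  ∀ x, (∀ i ∈ nnSet k S x, 1 / 2 + Δ < η (S i).1) → (k : ℝ) / 2 ≤ labelSum k S x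

/-- The `k` nearest neighbors of any point vote for the label `0` whenever all of them have
`η < 1 / 2 - Δ`. -/
def VotesZero (η : E d → ℝ) (k : ℕ) (Δ : ℝ) (S : Sample d n) : Prop :=
  ∀ x, (∀ i ∈ nnSet k S x, η (S i).1 < 1 / 2 - Δ) → labelSum k S x < (k : ℝ) / 2

/-- The classifier `f` takes the label of either strict interior on the whole `r`-neighborhood of
that interior. -/
def IsRobust (𝒳 : Set (E d)) (D : Measure (Example d)) (η : E d → ℝ) (r Δ p : ℝ)
    (f : E d → Fin 2) : Prop :=
  (∀ x ∈ strictInteriorPos 𝒳 D.fst η r Δ p, ∀ x' ∈ 𝒳, dist x' x < r → f x' = 1) ∧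
  ∀ x ∈ strictInteriorNeg 𝒳 D.fst η r Δ p, ∀ x' ∈ 𝒳, dist x' x < r → f x' = 0

lemma IsTypical.edist_le [IsFiniteMeasure D] {S : Sample d n} (hS : IsTypical 𝒳 D k p S)
    (x : E d) {i : Fin n} (hi : i ∈ nnSet k S x) : edist (S i).1 x ≤ probRadius D.fst p x := by
  by_cases h : probRadius D.fst p x = ∞
  · simp [h]
  · rw [← ENNReal.ofReal_toReal h, edist_le_ofReal ENNReal.toReal_nonneg]
    exact dist_le_of_mem_nnSet (hS.le_card x _ (le_measure_closedBall_probRadius h)) hi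

lemma IsTypical.knn_eq_one [IsFiniteMeasure D] {S : Sample d n} (hS : IsTypical 𝒳 D k p S)
    (hvote : VotesOne η k Δ S) {x x' : E d} (hx : x ∈ strictInteriorPos 𝒳 D.fst η r Δ p)
    (hx' : x' ∈ 𝒳) (hd : dist x' x < r) : knn k S x' = 1 :=
  KNN.knn_eq_one (hvote x' fun i hi => hx.2.2 x' hx' hd _ (hS.mem i) (hS.edist_le x' hi))

lemma IsTypical.knn_eq_zero [IsFiniteMeasure D] {S : Sample d n} (hS : IsTypical 𝒳 D k p S)
    (hvote : VotesZero η k Δ S) {x x' : E d} (hx : x ∈ strictInteriorNeg 𝒳 D.fst η r Δ p)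
    (hx' : x' ∈ 𝒳) (hd : dist x' x < r) : knn k S x' = 0 :=
  KNN.knn_eq_zero (hvote x' fun i hi => hx.2.2 x' hx' hd _ (hS.mem i) (hS.edist_le x' hi))

lemma le_robustnessRadius {f : E d → Fin 2} {x : E d} (hx : x ∈ 𝒳) (hr : 0 < r) {y : Fin 2}
    (h : ∀ x' ∈ 𝒳, dist x' x < r → f x' = y) :
    ENNReal.ofReal r ≤ robustnessRadius 𝒳 f x := by
  refine le_sInf ?_
  rintro s ⟨x', hx', hs, hne⟩
  by_contra! hlt
  refine hne ((h x hx (by simpa using hr)).trans (h x' hx' ?_).symm)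
  have := hs.trans_lt hlt
  rwa [edist_dist, ENNReal.ofReal_lt_ofReal_iff hr] at this

lemma IsRobust.le_robustnessRadius {f : E d → Fin 2} (hf : IsRobust 𝒳 D η r Δ p f) (hr : 0 < r)
    {x : E d} (hx : x ∈ strictInteriorPos 𝒳 D.fst η r Δ p ∪ strictInteriorNeg 𝒳 D.fst η r Δ p) :
    ENNReal.ofReal r ≤ robustnessRadius 𝒳 f x := by
  rcases hx with hx | hx
  · exact KNN.le_robustnessRadius hx.1 hr (hf.1 x hx)
  · exact KNN.le_robustnessRadius hx.1 hr (hf.2 x hx)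

/-- The sets `P` and `N` need not be measurable: the integrals over them are integrals over
measurable hulls, which the slices of a measurable hull of `T` contain up to null sets. -/
lemma setIntegral_add_setIntegral_le [IsProbabilityMeasure D] (hη : IsCondLabelProb D η)
    {P N : Set (E d)} {T : Set (Example d)} (hP : ∀ x ∈ P, (x, 1) ∈ T)
    (hN : ∀ x ∈ N, (x, 0) ∈ T) :
    (∫ x in P, η x ∂D.fst) + (∫ x in N, (1 - η x) ∂D.fst) ≤ D.real T := by
  let T' := toMeasurable D T
  have hT' : MeasurableSet T' := measurableSet_toMeasurable _ _
  let slice : Fin 2 → Set (E d) := fun y => (fun x => (x, y)) ⁻¹' T'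
  have hsl : ∀ y, MeasurableSet (slice y) := fun y => measurable_prodMk_right hT'
  have part : ∀ (y : Fin 2) (g : E d → ℝ), Measurable g → (∀ x, g x ∈ Set.Icc (0 : ℝ) 1) →
      (∀ φ : E d → ℝ≥0∞, Measurable φ →
        ∫⁻ z, φ z.1 * (if z.2 = y then 1 else 0) ∂D = ∫⁻ x, φ x * ENNReal.ofReal (g x) ∂D.fst) →
      ∀ Q ⊆ slice y, ∫ x in Q, g x ∂D.fst ≤ D.real (slice y ×ˢ {y}) := by
    intro y g hg h01 hint Q hQ
    have hgi : Integrable g D.fst := Integrable.of_bound hg.aestronglyMeasurable 1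
      (Eventually.of_forall fun x => by
        rw [Real.norm_of_nonneg (h01 x).1]; exact (h01 x).2)
    refine (setIntegral_mono_set (t := slice y) hgi.integrableOn
      (Eventually.of_forall fun x => (h01 x).1)
      (Eventually.of_forall hQ)).trans (le_of_eq ?_)
    rw [integral_eq_lintegral_of_nonneg_ae (Eventually.of_forall fun x => (h01 x).1)
      hg.aestronglyMeasurable, measureReal_def]
    congr 1
    have h1 := hint ((slice y).indicator 1) (measurable_one.indicator (hsl y))
    rw [← lintegral_indicator (hsl y)]
    rw [← lintegral_indicator_one ((hsl y).prod (measurableSet_singleton y))]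
    refine Eq.trans ?_ (h1.symm.trans ?_)
    · refine lintegral_congr fun x => ?_
      by_cases hx : x ∈ slice y <;> simp [hx]
    · refine lintegral_congr fun z => ?_
      by_cases hx : z.1 ∈ slice y <;> by_cases hy : z.2 = y <;>
        simp [Set.mem_prod, hx, hy]
  have h1 := part 1 η hη.measurable hη.mem_Icc (fun φ hφ => by
    rw [hη.lintegral_mul hφ fun y => if y = 1 then 1 else 0]; simp) P
    fun x hx => subset_toMeasurable D T (hP x hx)
  have h0 := part 0 (fun x => 1 - η x) (measurable_const.sub hη.measurable)
    (fun x => ⟨by linarith [(hη.mem_Icc x).2], by linarith [(hη.mem_Icc x).1]⟩) (fun φ hφ => by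
    rw [hη.lintegral_mul hφ fun y => if y = 0 then 1 else 0]; simp) N
    fun x hx => subset_toMeasurable D T (hN x hx)
  have hdisj : Disjoint (slice 1 ×ˢ ({1} : Set (Fin 2))) (slice 0 ×ˢ {0}) :=
    Set.disjoint_left.2 fun z hz hz' => by
      have e1 : z.2 = 1 := hz.2
      have e0 : z.2 = 0 := hz'.2
      simp [e1] at e0
  have hun : slice 1 ×ˢ ({1} : Set (Fin 2)) ∪ slice 0 ×ˢ {0} ⊆ T' := by
    rintro ⟨x, y⟩ (⟨hx, hy⟩ | ⟨hx, hy⟩)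
    · rw [Set.mem_singleton_iff] at hy; subst hy; exact hx
    · rw [Set.mem_singleton_iff] at hy; subst hy; exact hx
  have hT : D.real T' = D.real T := by
    rw [measureReal_def, measureReal_def, measure_toMeasurable]
  rw [← hT]
  refine (add_le_add h1 h0).trans (le_trans (le_of_eq ?_) (measureReal_mono hun))
  exact (measureReal_union hdisj ((hsl 0).prod (measurableSet_singleton 0))).symm

lemma IsRobust.le_astuteness [IsProbabilityMeasure D] (hη : IsCondLabelProb D η)
    {f : E d → Fin 2} (hf : IsRobust 𝒳 D η r Δ p f) (hr : 0 < r) :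
    (∫ x in strictInteriorPos 𝒳 D.fst η r Δ p, η x ∂D.fst) +
      (∫ x in strictInteriorNeg 𝒳 D.fst η r Δ p, (1 - η x) ∂D.fst) ≤ astuteness 𝒳 D f r :=
  setIntegral_add_setIntegral_le hη
    (fun x hx => ⟨hf.le_robustnessRadius hr (Or.inl hx), hf.1 x hx x hx.1 (by simpa using hr)⟩)
    (fun x hx => ⟨hf.le_robustnessRadius hr (Or.inr hx), hf.2 x hx x hx.1 (by simpa using hr)⟩)

lemma holdsWithProb_of_compl_le {Ω : Type*} [MeasurableSpace Ω] {P : Measure Ω}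
    [IsProbabilityMeasure P] {good : Ω → Prop} (hδ : 0 ≤ δ)
    (h : P {ω | ¬ good ω} ≤ ENNReal.ofReal δ) : HoldsWithProb P (1 - δ) good := by
  refine ⟨(toMeasurable P {ω | ¬ good ω})ᶜ, (measurableSet_toMeasurable _ _).compl, ?_,
    fun ω hω => ?_⟩
  · rw [probReal_compl_eq_one_sub (measurableSet_toMeasurable _ _), measureReal_def,
      measure_toMeasurable]
    have := ENNReal.toReal_le_of_le_ofReal hδ h
    linarith
  · by_contra hg
    exact hω (subset_toMeasurable P {ω | ¬ good ω} hg)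

/-- A single event of probability at least `1 - δ` serves both guarantees. -/
lemma guarantees_of_isRobust [IsProbabilityMeasure D] (hη : IsCondLabelProb D η) (hr : 0 < r)
    (hδ : 0 ≤ δ)
    (h : sampleLaw D n {S | ¬ IsRobust 𝒳 D η r Δ p (knn k S)} ≤ ENNReal.ofReal δ) :
    RobustnessGuarantee 𝒳 D η n k r Δ p δ ∧ AstutenessGuarantee 𝒳 D η n k r Δ p δ := by
  obtain ⟨A, hA, hP, hgood⟩ := holdsWithProb_of_compl_le hδ h
  exact ⟨⟨A, hA, by linarith, fun S hS x hx => (hgood S hS).le_robustnessRadius hr hx⟩,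
    ⟨A, hA, hP, fun S hS => (hgood S hS).le_astuteness hη hr⟩⟩

end Deterministic

/-! ### Probability of an atypical sample -/

section Probability

variable {d n k : ℕ} {𝒳 : Set (E d)} {D : Measure (Example d)} {η : E d → ℝ} {r Δ p δ : ℝ}

lemma sampleLaw_exists_notMem [IsProbabilityMeasure D] (h𝒳 : MeasurableSet 𝒳)
    (hD : D.fst 𝒳ᶜ = 0) : sampleLaw D n {S | ¬ ∀ i, (S i).1 ∈ 𝒳} = 0 := by
  have : {S : Sample d n | ¬ ∀ i, (S i).1 ∈ 𝒳} =
      ⋃ i, Function.eval i ⁻¹' (Prod.fst ⁻¹' 𝒳ᶜ) := by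
    ext S; simp
  rw [this, measure_iUnion_null_iff]
  intro i
  have hm : MeasurableSet (Prod.fst ⁻¹' 𝒳ᶜ : Set (Example d)) := measurable_fst h𝒳.compl
  rw [sampleLaw, (measurePreserving_eval (fun _ : Fin n => D) i).measure_preimage
    hm.nullMeasurableSet, ← Measure.fst_apply h𝒳.compl, hD]

/-- The sparse-set bound for the countable family of balls, which transfers to all closed balls. -/
lemma sampleLaw_not_isTypical_le [IsProbabilityMeasure D] (h𝒳 : MeasurableSet 𝒳)
    (hD : D.fst 𝒳ᶜ = 0) {t : ℝ} (h0 : 0 ≤ t) (h1 : t ≤ 1 / 2) :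
    sampleLaw D n {S | ¬ IsTypical 𝒳 D k p S} ≤ ENNReal.ofReal
      (((2 * n + 1) ^ (d + 3) : ℕ) * Real.exp (-(t * ((1 - 2 * t) * (n * p) - k)))) := by
  classical
  have hsparse := pi_exists_sparse_le (ν := D) (n := n)
    (A := fun w => Prod.fst ⁻¹' ballFamily d w)
    (fun w => measurable_fst Metric.isOpen_ball.measurableSet) card_traces_ballFamily_le
    h0 h1 (n * p) k
  refine (measure_mono ?_).trans ((measure_union_le _ _).trans
    ((add_le_add (sampleLaw_exists_notMem h𝒳 hD).le hsparse).trans_eq (zero_add _)))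
  intro S hS
  by_contra hS'
  rw [Set.mem_union, not_or] at hS'
  obtain ⟨hmem, hsp⟩ := hS'
  refine hS ⟨not_not.1 hmem, fun x R hR => ?_⟩
  by_contra! hlt
  obtain ⟨w, hw, hwX⟩ := exists_closedBall_subset_ballFamily (fun i => (S i).1) x R
  refine hsp ⟨w, ?_, lt_of_le_of_lt (Finset.card_le_card fun i hi => ?_) hlt⟩
  · refine mul_le_mul_of_nonneg_left ?_ (Nat.cast_nonneg n)
    have h2 := hR.trans (measure_mono hw)
    rw [Measure.fst_apply (s := ballFamily d w) Metric.isOpen_ball.measurableSet] at h2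
    exact (ENNReal.ofReal_le_iff_le_toReal (measure_ne_top _ _)).1 h2
  · simp only [Finset.mem_filter, Finset.mem_univ, true_and, Set.mem_preimage] at hi ⊢
    exact hwX i hi

/-- Balls of probability at least `p > 1` do not exist. -/
lemma sampleLaw_not_isTypical_of_one_lt [IsProbabilityMeasure D] (h𝒳 : MeasurableSet 𝒳)
    (hD : D.fst 𝒳ᶜ = 0) (hp : 1 < p) : sampleLaw D n {S | ¬ IsTypical 𝒳 D k p S} = 0 := by
  refine measure_mono_null (fun S hS hmem => hS ⟨hmem, fun x R hR => ?_⟩)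
    (sampleLaw_exists_notMem h𝒳 hD)
  have h1 := hR.trans prob_le_one
  rw [← ENNReal.ofReal_one, ENNReal.ofReal_le_ofReal_iff zero_le_one] at h1
  linarith

/-- The moment generating function of a label that is biased by `Δ`, at the parameter `2 * Δ`. -/
lemma biased_label_mgf_le (h0 : 0 ≤ Δ) (h1 : Δ ≤ 1 / 2) {q : ℝ} (hq : 1 / 2 + Δ ≤ q) :
    q * Real.exp (-Δ) + (1 - q) * Real.exp Δ ≤ Real.exp (-Δ ^ 2) := by
  have hc := Real.cosh_le_exp_half_sq Δ
  have hs := Real.self_le_sinh_iff.2 h0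
  have e1 := Real.cosh_eq Δ
  have e2 := Real.sinh_eq Δ
  have hb := (abs_le.1 (Real.abs_exp_sub_one_sub_id_le (x := Δ ^ 2 / 2)
    (by rw [abs_of_nonneg (by positivity)]; nlinarith))).2
  have hl := Real.add_one_le_exp (-Δ ^ 2)
  have h3 : (q - 1 / 2) * (2 * Real.sinh Δ) ≥ Δ * (2 * Δ) := by
    apply mul_le_mul <;> linarith
  have h4 : (Δ ^ 2 / 2) ^ 2 ≤ Δ ^ 2 / 2 := by
    have : Δ ^ 2 ≤ 1 := by nlinarith
    nlinarith [mul_le_mul_of_nonneg_left this (sq_nonneg Δ)]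
  have h5 : q * Real.exp (-Δ) + (1 - q) * Real.exp Δ =
      Real.cosh Δ - (q - 1 / 2) * (2 * Real.sinh Δ) := by
    rw [e1, e2]; ring
  rw [h5]
  linarith

lemma prod_exp_label {S : Sample d n} {I : Finset (Fin n)} (a b : ℝ) :
    ∏ i ∈ I, ENNReal.ofReal (Real.exp (a + b * ((S i).2 : ℕ))) =
      ENNReal.ofReal (Real.exp (I.card * a + b * ∑ i ∈ I, (((S i).2 : ℕ) : ℝ))) := by
  rw [← ENNReal.ofReal_prod_of_nonneg fun _ _ => (Real.exp_pos _).le, ← Real.exp_sum,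
    Finset.sum_add_distrib, Finset.mul_sum]
  simp

lemma sampleLaw_not_votesOne_le [IsProbabilityMeasure D] (hη : IsCondLabelProb D η) (hk : k ≤ n)
    (h0 : 0 ≤ Δ) (h1 : Δ ≤ 1 / 2) {N : ℕ}
    (hN : ∀ X : Fin n → E d, ((traces (tieBall X)).filter fun I => I.card = k).card ≤ N) :
    sampleLaw D n {S | ¬ VotesOne η k Δ S} ≤ ENNReal.ofReal (N * Real.exp (-(k * Δ ^ 2))) := by
  have hG : MeasurableSet {x | 1 / 2 + Δ < η x} := measurableSet_lt measurable_const hη.measurable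
  have h := sampleLaw_exists_trace_le hη (n := n) measurableSet_tieBall hN hG
    (h := fun y => ENNReal.ofReal (Real.exp (Δ + (-2 * Δ) * (y : ℕ))))
    (c := ENNReal.ofReal (Real.exp (-Δ ^ 2))) fun x hx => by
      have hx1 := (hη.mem_Icc x).2
      rw [← ENNReal.ofReal_mul (hη.mem_Icc x).1, ← ENNReal.ofReal_mul (by linarith),
        ← ENNReal.ofReal_add (mul_nonneg (hη.mem_Icc x).1 (Real.exp_pos _).le)
          (mul_nonneg (by linarith) (Real.exp_pos _).le)]
      refine ENNReal.ofReal_le_ofReal (le_trans (le_of_eq ?_)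
        (biased_label_mgf_le h0 h1 (le_of_lt hx)))
      simp only [Fin.isValue, Fin.val_one, Fin.val_zero, Nat.cast_one, Nat.cast_zero]
      ring_nf
  refine (measure_mono fun S hS => ?_).trans (h.trans_eq ?_)
  · -- A wrong vote makes the product of the weights `exp (Δ - 2 * Δ * Y)` at least `1`.
    simp only [VotesOne, Set.mem_ofPred_eq, not_forall, not_le] at hS
    obtain ⟨x, hx, hlt⟩ := hS
    refine ⟨nnSet k S x, nnSet_mem_traces k S x, card_nnSet hk S x, hx, ?_⟩
    rw [prod_exp_label, card_nnSet hk, ← ENNReal.ofReal_one]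
    refine ENNReal.ofReal_le_ofReal (Real.one_le_exp ?_)
    rw [labelSum] at hlt
    nlinarith
  · rw [ENNReal.ofReal_mul (Nat.cast_nonneg N), ENNReal.ofReal_natCast,
      ← ENNReal.ofReal_pow (Real.exp_pos _).le, ← Real.exp_nat_mul]
    ring_nf

lemma sampleLaw_not_votesZero_le [IsProbabilityMeasure D] (hη : IsCondLabelProb D η) (hk : k ≤ n)
    (h0 : 0 ≤ Δ) (h1 : Δ ≤ 1 / 2) {N : ℕ}
    (hN : ∀ X : Fin n → E d, ((traces (tieBall X)).filter fun I => I.card = k).card ≤ N) :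
    sampleLaw D n {S | ¬ VotesZero η k Δ S} ≤ ENNReal.ofReal (N * Real.exp (-(k * Δ ^ 2))) := by
  have hG : MeasurableSet {x | η x < 1 / 2 - Δ} := measurableSet_lt hη.measurable measurable_const
  have h := sampleLaw_exists_trace_le hη (n := n) measurableSet_tieBall hN hG
    (h := fun y => ENNReal.ofReal (Real.exp (-Δ + (2 * Δ) * (y : ℕ))))
    (c := ENNReal.ofReal (Real.exp (-Δ ^ 2))) fun x hx => by
      have hx1 := (hη.mem_Icc x).2
      rw [← ENNReal.ofReal_mul (hη.mem_Icc x).1, ← ENNReal.ofReal_mul (by linarith),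
        ← ENNReal.ofReal_add (mul_nonneg (hη.mem_Icc x).1 (Real.exp_pos _).le)
          (mul_nonneg (by linarith) (Real.exp_pos _).le)]
      refine ENNReal.ofReal_le_ofReal (le_trans (le_of_eq ?_)
        (biased_label_mgf_le h0 h1 (q := 1 - η x) (by linarith [show η x < 1 / 2 - Δ from hx])))
      simp only [Fin.isValue, Fin.val_one, Fin.val_zero, Nat.cast_one, Nat.cast_zero]
      ring_nf
  refine (measure_mono fun S hS => ?_).trans (h.trans_eq ?_)
  · simp only [VotesZero, Set.mem_ofPred_eq, not_forall, not_lt] at hS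
    obtain ⟨x, hx, hle⟩ := hS
    refine ⟨nnSet k S x, nnSet_mem_traces k S x, card_nnSet hk S x, hx, ?_⟩
    rw [prod_exp_label, card_nnSet hk, ← ENNReal.ofReal_one]
    refine ENNReal.ofReal_le_ofReal (Real.one_le_exp ?_)
    rw [labelSum] at hle
    nlinarith
  · rw [ENNReal.ofReal_mul (Nat.cast_nonneg N), ENNReal.ofReal_natCast,
      ← ENNReal.ofReal_pow (Real.exp_pos _).le, ← Real.exp_nat_mul]
    ring_nf

end Probability

/-! ### Choice of the constants -/

section Constants

variable {d n k : ℕ} {𝒳 : Set (E d)} {D : Measure (Example d)} {η : E d → ℝ} {r Δ p δ : ℝ}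

/-- The complexity `d log n + log (1 / δ)` is positive since `δ < 1`. -/
lemma complexity_pos (hn : 1 ≤ n) (h0 : 0 < δ) (h1 : δ < 1) :
    0 < d * Real.log n + Real.log (1 / δ) := by
  have := Real.log_pos (show 1 < 1 / δ by rw [lt_div_iff₀ h0]; linarith)
  have := Real.log_nonneg (show (1 : ℝ) ≤ n by exact_mod_cast hn)
  positivity

/-- A polynomial number of traces is negligible against an exponent of `16` complexities. -/
lemma pow_mul_exp_le (hd : 1 ≤ d) (hn : 2 ≤ n) (h0 : 0 < δ) (h1 : δ < 1) {a : ℝ}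
    (ha : 16 * (d * Real.log n + Real.log (1 / δ)) ≤ a) {N : ℕ}
    (hN : N ≤ (2 * n + 1) ^ (d + 3)) : N * Real.exp (-a) ≤ δ / 3 := by
  have hn0 : (0 : ℝ) < n := by positivity
  have hlog2 : Real.log 2 ≤ Real.log n := Real.log_le_log two_pos (by exact_mod_cast hn)
  have hlog2' := Real.log_two_gt_d9
  have hδ := Real.log_pos (show 1 < 1 / δ by rw [lt_div_iff₀ h0]; linarith)
  have hd' : (1 : ℝ) ≤ d := by exact_mod_cast hd
  have hN' : N ≤ n ^ (12 * d) :=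
    calc N ≤ (2 * n + 1) ^ (d + 3) := hN
      _ ≤ (n ^ 3) ^ (d + 3) := Nat.pow_le_pow_left (by nlinarith [Nat.mul_le_mul hn hn]) _
      _ = n ^ (3 * (d + 3)) := by rw [← pow_mul]
      _ ≤ n ^ (12 * d) := Nat.pow_le_pow_right (by omega) (by omega)
  have hNe : (N : ℝ) ≤ Real.exp (12 * d * Real.log n) := by
    rw [mul_comm, Real.exp_mul, Real.exp_log hn0]
    have : ((n ^ (12 * d) : ℕ) : ℝ) = (n : ℝ) ^ (12 * d : ℝ) := by
      rw [show (12 * d : ℝ) = ((12 * d : ℕ) : ℝ) by push_cast; ring, Real.rpow_natCast,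
        Nat.cast_pow]
    rw [← this]
    exact_mod_cast hN'
  calc N * Real.exp (-a) ≤ Real.exp (12 * d * Real.log n) * Real.exp (-a) := by gcongr
    _ = Real.exp (12 * d * Real.log n - a) := by rw [← Real.exp_add]; ring_nf
    _ ≤ Real.exp (-(4 * Real.log 2) - Real.log (1 / δ)) := by
        refine Real.exp_le_exp.2 ?_
        nlinarith [mul_le_mul hd' hlog2 (by linarith) (by linarith)]
    _ = δ / 16 := by
        rw [Real.exp_sub, Real.exp_log (by positivity), Real.exp_neg, mul_comm, Real.exp_mul,
          Real.exp_log two_pos]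
        norm_num
        ring
    _ ≤ δ / 3 := by linarith

lemma guarantees_of_two_le [IsProbabilityMeasure D] (hd : 1 ≤ d) (h𝒳 : MeasurableSet 𝒳)
    (hD : D.fst 𝒳ᶜ = 0) (hη : IsCondLabelProb D η) (hr : 0 < r) (hn : 2 ≤ n) (h0 : 0 < δ)
    (h1 : δ < 1) (hΔ : 0 < Δ) (hΔ' : Δ ≤ 1 / 2) (hk : k ≤ n) (hk0 : 0 < k)
    (hkΔ : 64 * (d * Real.log n + Real.log (1 / δ)) ≤ k * Δ ^ 2)
    (hp : (k : ℝ) / n * (1 + 16 * √((d * Real.log n + Real.log (1 / δ)) / k)) ≤ p) :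
    RobustnessGuarantee 𝒳 D η n k r Δ p δ ∧ AstutenessGuarantee 𝒳 D η n k r Δ p δ := by
  set L := d * Real.log n + Real.log (1 / δ) with hL
  have hLpos : 0 < L := complexity_pos (by omega) h0 h1
  have hk' : (0 : ℝ) < k := by exact_mod_cast hk0
  have hn' : (0 : ℝ) < n := by positivity
  set u := √(L / k) with hu
  have hu0 : 0 ≤ u := Real.sqrt_nonneg _
  have huL : k * u ^ 2 = L := by
    rw [hu, Real.sq_sqrt (by positivity)]; field_simp
  have hu16 : u ≤ 1 / 16 := by
    refine Real.sqrt_le_iff.2 ⟨by norm_num, ?_⟩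
    rw [div_le_iff₀ hk']
    have hΔ2 : Δ ^ 2 ≤ 1 / 4 := by nlinarith
    have := mul_le_mul_of_nonneg_left hΔ2 hk'.le
    linarith
  have hnp : k * (1 + 16 * u) ≤ n * p := by
    have := mul_le_mul_of_nonneg_left hp hn'.le
    calc k * (1 + 16 * u) = n * (k / n * (1 + 16 * u)) := by field_simp
      _ ≤ n * p := this
  -- The parameter `t = 2 * u` makes the exponent `2 * L * (12 - 64 * u)`, at least `16 * L`.
  have hexp : 16 * L ≤ 2 * u * ((1 - 2 * (2 * u)) * (n * p) - k) :=
    calc 16 * L ≤ 2 * u * ((1 - 2 * (2 * u)) * (k * (1 + 16 * u)) - k) := by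
          rw [← huL]
          nlinarith [mul_nonneg (mul_nonneg hk'.le (sq_nonneg u)) (sub_nonneg.2 hu16)]
      _ ≤ _ := by gcongr; linarith
  refine guarantees_of_isRobust hη hr h0.le ?_
  have htyp := (sampleLaw_not_isTypical_le (n := n) (k := k) (p := p) h𝒳 hD (t := 2 * u)
    (by linarith) (by linarith)).trans (ENNReal.ofReal_le_ofReal
      (pow_mul_exp_le hd hn h0 h1 hexp le_rfl))
  have hN : ∀ X : Fin n → E d,
      ((traces (tieBall X)).filter fun I => I.card = k).card ≤ (n + 1) ^ (d + 3) := fun X =>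
    (Finset.card_filter_le _ _).trans (card_traces_tieBall_le X)
  have hN' : (n + 1) ^ (d + 3) ≤ (2 * n + 1) ^ (d + 3) := Nat.pow_le_pow_left (by omega) _
  have hvote : (((n + 1) ^ (d + 3) : ℕ) : ℝ) * Real.exp (-(k * Δ ^ 2)) ≤ δ / 3 :=
    pow_mul_exp_le hd hn h0 h1 (by linarith) hN'
  have hone := (sampleLaw_not_votesOne_le hη hk hΔ.le hΔ' hN).trans
    (ENNReal.ofReal_le_ofReal hvote)
  have hzero := (sampleLaw_not_votesZero_le hη hk hΔ.le hΔ' hN).trans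
    (ENNReal.ofReal_le_ofReal hvote)
  calc sampleLaw D n {S | ¬ IsRobust 𝒳 D η r Δ p (knn k S)}
      ≤ sampleLaw D n ({S | ¬ IsTypical 𝒳 D k p S} ∪
          ({S | ¬ VotesOne η k Δ S} ∪ {S | ¬ VotesZero η k Δ S})) := by
        refine measure_mono fun S hS => ?_
        by_contra hS'
        simp only [Set.mem_union, Set.mem_ofPred_eq, not_or, not_not] at hS'
        obtain ⟨ht, h1, h0⟩ := hS'
        exact hS ⟨fun x hx x' hx' hd => ht.knn_eq_one h1 hx hx' hd,
          fun x hx x' hx' hd => ht.knn_eq_zero h0 hx hx' hd⟩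
    _ ≤ ENNReal.ofReal (δ / 3) + (ENNReal.ofReal (δ / 3) + ENNReal.ofReal (δ / 3)) :=
        (measure_union_le _ _).trans
          (add_le_add htyp ((measure_union_le _ _).trans (add_le_add hone hzero)))
    _ = ENNReal.ofReal δ := by
        rw [← ENNReal.ofReal_add (by positivity) (by positivity),
          ← ENNReal.ofReal_add (by positivity) (by positivity)]
        ring_nf

/-- With a single sample point the union bound over traces is too lossy when `δ` is close to `1`.
But then `p > 1`, so that all probability radii are infinite, at most one of the strict interiors
is non-empty, and only one vote has to be controlled. -/
lemma guarantees_of_eq_one [IsProbabilityMeasure D] (h𝒳 : MeasurableSet 𝒳)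
    (hD : D.fst 𝒳ᶜ = 0) (hη : IsCondLabelProb D η) (hr : 0 < r) (h0 : 0 < δ)
    (hΔ : 0 < Δ) (hΔ' : Δ ≤ 1 / 2) (hkΔ : Real.log (1 / δ) ≤ Δ ^ 2) (hp : 1 < p) :
    RobustnessGuarantee 𝒳 D η 1 1 r Δ p δ ∧ AstutenessGuarantee 𝒳 D η 1 1 r Δ p δ := by
  refine guarantees_of_isRobust hη hr h0.le ?_
  have htyp := sampleLaw_not_isTypical_of_one_lt (n := 1) (k := 1) h𝒳 hD hp
  have hN : ∀ X : Fin 1 → E d, ((traces (tieBall X)).filter fun I => I.card = 1).card ≤ 1 := by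
    intro X
    refine Finset.card_le_one.2 fun I hI J hJ => ?_
    have h1 := (Finset.mem_filter.1 hI).2
    have h2 := (Finset.mem_filter.1 hJ).2
    rw [Finset.card_eq_iff_eq_univ I |>.1 (by simpa using h1),
      Finset.card_eq_iff_eq_univ J |>.1 (by simpa using h2)]
  have hvote : ((1 : ℕ) : ℝ) * Real.exp (-((1 : ℕ) * Δ ^ 2)) ≤ δ := by
    rw [Nat.cast_one, one_mul, one_mul]
    calc Real.exp (-Δ ^ 2) ≤ Real.exp (-Real.log (1 / δ)) := Real.exp_le_exp.2 (by linarith)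
      _ = δ := by rw [one_div, Real.log_inv, neg_neg, Real.exp_log h0]
  have hrad : ∀ x, probRadius D.fst p x = ∞ := fun x => by
    by_contra h
    have h1 := (le_measure_closedBall_probRadius h).trans prob_le_one
    rw [← ENNReal.ofReal_one, ENNReal.ofReal_le_ofReal_iff zero_le_one] at h1
    linarith
  rcases (strictInteriorPos 𝒳 D.fst η r Δ p).eq_empty_or_nonempty with hP | ⟨y, hy⟩
  · calc sampleLaw D 1 {S | ¬ IsRobust 𝒳 D η r Δ p (knn 1 S)}
        ≤ sampleLaw D 1 ({S | ¬ IsTypical 𝒳 D 1 p S} ∪ {S | ¬ VotesZero η 1 Δ S}) := by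
          refine measure_mono fun S hS => ?_
          by_contra hS'
          simp only [Set.mem_union, Set.mem_ofPred_eq, not_or, not_not] at hS'
          exact hS ⟨fun x hx => by simp [hP] at hx,
            fun x hx x' hx' hd => hS'.1.knn_eq_zero hS'.2 hx hx' hd⟩
      _ ≤ 0 + ENNReal.ofReal δ := (measure_union_le _ _).trans (add_le_add htyp.le
          ((sampleLaw_not_votesZero_le hη le_rfl hΔ.le hΔ' hN).trans
            (ENNReal.ofReal_le_ofReal hvote)))
      _ = ENNReal.ofReal δ := zero_add _
  · have hM : ∀ x, x ∉ strictInteriorNeg 𝒳 D.fst η r Δ p := fun x hx => by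
      have e1 := hx.2.2 x hx.1 (by simpa using hr) x hx.1 (by simp)
      have e2 := hy.2.2 y hy.1 (by simpa using hr) x hx.1 (by simp [hrad])
      linarith
    calc sampleLaw D 1 {S | ¬ IsRobust 𝒳 D η r Δ p (knn 1 S)}
        ≤ sampleLaw D 1 ({S | ¬ IsTypical 𝒳 D 1 p S} ∪ {S | ¬ VotesOne η 1 Δ S}) := by
          refine measure_mono fun S hS => ?_
          by_contra hS'
          simp only [Set.mem_union, Set.mem_ofPred_eq, not_or, not_not] at hS'
          exact hS ⟨fun x hx x' hx' hd => hS'.1.knn_eq_one hS'.2 hx hx' hd,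
            fun x hx => absurd hx (hM x)⟩
      _ ≤ 0 + ENNReal.ofReal δ := (measure_union_le _ _).trans (add_le_add htyp.le
          ((sampleLaw_not_votesOne_le hη le_rfl hΔ.le hΔ' hN).trans
            (ENNReal.ofReal_le_ofReal hvote)))
      _ = ENNReal.ofReal δ := zero_add _

/-- For `Δ ≥ 1 / 2` both strict interiors are empty. -/
lemma guarantees_of_half_le [IsProbabilityMeasure D] (hη : IsCondLabelProb D η) (hr : 0 < r)
    (h0 : 0 < δ) (hΔ : 1 / 2 ≤ Δ) :
    RobustnessGuarantee 𝒳 D η n k r Δ p δ ∧ AstutenessGuarantee 𝒳 D η n k r Δ p δ := by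
  refine guarantees_of_isRobust hη hr h0.le ?_
  have : {S : Sample d n | ¬ IsRobust 𝒳 D η r Δ p (knn k S)} = ∅ := by
    refine Set.eq_empty_of_forall_notMem fun S hS => hS ⟨fun x hx => ?_, fun x hx => ?_⟩
    · have := hx.2.2 x hx.1 (by simpa using hr) x hx.1 (by simp)
      linarith [(hη.mem_Icc x).2]
    · have := hx.2.2 x hx.1 (by simpa using hr) x hx.1 (by simp)
      linarith [(hη.mem_Icc x).1]
  simp [this]

/-- Both guarantees, under the conditions of the first form with `C₁ = 8` and `C₂ = 16`. -/
lemma guarantees [IsProbabilityMeasure D] (hd : 1 ≤ d) (h𝒳 : MeasurableSet 𝒳)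
    (hD : D.fst 𝒳ᶜ = 0) (hη : IsCondLabelProb D η) (hr : 0 < r) (hn : 1 ≤ n) (h0 : 0 < δ)
    (h1 : δ < 1) (hΔ : 0 < Δ) (hk : k ≤ n)
    (hkΔ : 8 * √(n * (d * Real.log n + Real.log (1 / δ))) ≤ k * Δ)
    (hp : (k : ℝ) / n * (1 + 16 * √((d * Real.log n + Real.log (1 / δ)) / k)) ≤ p) :
    RobustnessGuarantee 𝒳 D η n k r Δ p δ ∧ AstutenessGuarantee 𝒳 D η n k r Δ p δ := by
  rcases le_total (1 / 2) Δ with hΔ' | hΔ'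
  · exact guarantees_of_half_le hη hr h0 hΔ'
  have hL : 0 < d * Real.log n + Real.log (1 / δ) := complexity_pos hn h0 h1
  have hn' : (0 : ℝ) < n := by exact_mod_cast hn
  have hpos : 0 < k * Δ := lt_of_lt_of_le (by positivity) hkΔ
  have hk' : (0 : ℝ) < k := pos_of_mul_pos_left hpos hΔ.le
  have hkn : (k : ℝ) ≤ n := by exact_mod_cast hk
  have hsq : 64 * (d * Real.log n + Real.log (1 / δ)) ≤ k * Δ ^ 2 := by
    have h2 := pow_le_pow_left₀ (by positivity) hkΔ 2
    rw [mul_pow, Real.sq_sqrt (by positivity)] at h2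
    -- As `k ≤ n`, the condition squared gives `64 * k * L ≤ 64 * n * L ≤ (k * Δ) ^ 2`.
    have h3 : k * (64 * (d * Real.log n + Real.log (1 / δ))) ≤ k * (k * Δ ^ 2) := by
      have := mul_le_mul_of_nonneg_right hkn hL.le
      nlinarith
    exact le_of_mul_le_mul_left h3 hk'
  have hk0 : 0 < k := by exact_mod_cast hk'
  rcases hn.eq_or_lt with rfl | hn2
  · obtain rfl : k = 1 := by omega
    simp only [Nat.cast_one, Real.log_one, mul_zero, zero_add, one_mul, div_one] at hL hsq hp
    refine guarantees_of_eq_one h𝒳 hD hη hr h0 hΔ hΔ' (by linarith) (lt_of_lt_of_le ?_ hp)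
    have := Real.sqrt_pos.2 hL
    linarith
  · exact guarantees_of_two_le hd h𝒳 hD hη hr hn2 h0 h1 hΔ hΔ' hk hk0 hsq hp

end Constants

/-! ### Approach to the regions of the Bayes classifier -/

section Limit

variable {d : ℕ} {𝒳 : Set (E d)} {μ : Measure (E d)} {η : E d → ℝ} {r s Δ p : ℝ}

/-- Exchanging the labels reduces statements on the class `0` to the class `1`. -/
lemma strictInteriorNeg_eq (𝒳 : Set (E d)) (μ : Measure (E d)) (η : E d → ℝ) (r Δ p : ℝ) :
    strictInteriorNeg 𝒳 μ η r Δ p = strictInteriorPos 𝒳 μ (fun x => 1 - η x) r Δ p := by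
  have : ∀ y : ℝ, y < 1 / 2 - Δ ↔ 1 / 2 + Δ < 1 - y := fun y => by
    constructor <;> intro h <;> linarith
  simp only [strictInteriorNeg, strictInteriorPos, this]

/-- With `p = 0` the probability radii vanish. -/
lemma mem_strictInteriorPos_zero {x : E d} :
    x ∈ strictInteriorPos 𝒳 μ η r 0 0 ↔
      x ∈ 𝒳 ∧ x ∈ μ.support ∧ ∀ x' ∈ 𝒳, dist x' x < r → 1 / 2 < η x' := by
  have hrad : ∀ y, probRadius μ 0 y = 0 := fun y =>
    le_antisymm (sInf_le (by simp)) zero_le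
  refine and_congr_right fun _ => and_congr_right fun _ => ⟨fun h x' hx' hd => ?_,
    fun h x' hx' hd x'' _ he => ?_⟩
  · simpa using h x' hx' hd x' hx' (by simp)
  · rw [hrad, nonpos_iff_eq_zero, edist_eq_zero] at he
    simpa [he] using h x' hx' hd

lemma strictInteriorPos_subset (hΔ : 0 ≤ Δ) :
    strictInteriorPos 𝒳 μ η r Δ p ⊆ strictInteriorPos 𝒳 μ η r 0 0 := fun _ hx =>
  mem_strictInteriorPos_zero.2 ⟨hx.1, hx.2.1, fun x' hx' hd => by
    linarith [hx.2.2 x' hx' hd x' hx' (by simp)]⟩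

/-- Balls of a fixed radius centered in a compact part of the support have probability bounded
away from zero. -/
lemma exists_le_measure_closedBall {K : Set (E d)} (hK : IsCompact K) (hsupp : K ⊆ μ.support)
    {h : ℝ} (hh : 0 < h) :
    ∃ c : ℝ, 0 < c ∧ ∀ y ∈ K, ENNReal.ofReal c ≤ μ (Metric.closedBall y h) := by
  refine hK.induction_on (p := fun K => ∃ c : ℝ, 0 < c ∧ ∀ y ∈ K,
    ENNReal.ofReal c ≤ μ (Metric.closedBall y h)) ⟨1, one_pos, by simp⟩ ?_ ?_ ?_
  · rintro A B hAB ⟨c, hc, hB⟩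
    exact ⟨c, hc, fun y hy => hB y (hAB hy)⟩
  · rintro A B ⟨a, ha, hA⟩ ⟨b, hb, hB⟩
    refine ⟨min a b, lt_min ha hb, fun y hy => ?_⟩
    rcases hy with hy | hy
    · exact (ENNReal.ofReal_le_ofReal (min_le_left _ _)).trans (hA y hy)
    · exact (ENNReal.ofReal_le_ofReal (min_le_right _ _)).trans (hB y hy)
  · intro x hx
    have hpos := (Measure.mem_support_iff_forall x).1 (hsupp hx) _
      (Metric.closedBall_mem_nhds x (half_pos hh))
    obtain ⟨c, -, hc0, hc⟩ := ENNReal.lt_iff_exists_real_btwn.1 hpos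
    refine ⟨Metric.ball x (h / 2),
      mem_nhdsWithin_of_mem_nhds (Metric.ball_mem_nhds x (half_pos hh)),
      c, ENNReal.ofReal_pos.1 hc0, fun y hy => hc.le.trans (measure_mono ?_)⟩
    refine Metric.closedBall_subset_closedBall' ?_
    rw [Metric.mem_ball, dist_comm] at hy
    linarith

/-- On the compact ball of a radius between `s` and `r` the margin of `η` is bounded below, and the
probability radii at the points of the `s`-ball are eventually at most `(r - s) / 2`. -/
lemma eventually_mem_strictInteriorPos (h𝒳 : IsClosed 𝒳) (hsupp : 𝒳 ⊆ μ.support)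
    (hη : ContinuousOn η 𝒳) {Δ p : ℕ → ℝ} (hΔ : Tendsto Δ atTop (𝓝 0))
    (hp : Tendsto p atTop (𝓝 0)) (hsr : s < r) {x : E d}
    (hx : x ∈ strictInteriorPos 𝒳 μ η r 0 0) :
    ∀ᶠ n in atTop, x ∈ strictInteriorPos 𝒳 μ η s (Δ n) (p n) := by
  obtain ⟨hx𝒳, hxs, hxη⟩ := mem_strictInteriorPos_zero.1 hx
  set h := (r - s) / 2 with hh
  have hh0 : 0 < h := by linarith
  have hK : IsCompact (𝒳 ∩ Metric.closedBall x (s + h)) :=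
    (isCompact_closedBall x (s + h)).inter_left h𝒳
  obtain ⟨a, ha, haK⟩ := hK.exists_forall_le' (hη.mono Set.inter_subset_left) (a := 1 / 2)
    fun y hy => hxη y hy.1 (lt_of_le_of_lt (Metric.mem_closedBall.1 hy.2) (by linarith))
  obtain ⟨c, hc, hcK⟩ := exists_le_measure_closedBall hK
    (Set.inter_subset_left.trans hsupp) hh0
  filter_upwards [hΔ.eventually_lt_const (sub_pos.2 ha), hp.eventually_lt_const hc] with n hΔn hpn
  refine ⟨hx𝒳, hxs, fun x' hx' hd x'' hx'' he => ?_⟩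
  have hrad : probRadius μ (p n) x' ≤ ENNReal.ofReal h := by
    refine sInf_le ((ENNReal.ofReal_le_ofReal hpn.le).trans ((hcK x' ⟨hx', ?_⟩).trans_eq ?_))
    · rw [Metric.mem_closedBall]; linarith
    · congr 1
      ext y
      simp [edist_le_ofReal hh0.le]
  have hd' := (edist_le_ofReal hh0.le).1 (he.trans hrad)
  have := haK x'' ⟨hx'', by
    rw [Metric.mem_closedBall]; linarith [dist_triangle x'' x' x]⟩
  linarith

end Limit

end KNN

theorem theorem3 :
    -- first form: conditions up to universal constants
    (∃ C₁ : ℝ, 0 < C₁ ∧ ∃ C₂ : ℝ, 0 < C₂ ∧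
      ∀ (d : ℕ), 1 ≤ d →
      ∀ (𝒳 : Set (KNN.E d)), MeasurableSet 𝒳 →
      ∀ (D : Measure (KNN.Example d)), IsProbabilityMeasure D → D.fst 𝒳ᶜ = 0 →
      ∀ (η : KNN.E d → ℝ), KNN.IsCondLabelProb D η →
      ∀ (r : ℝ), 0 < r →
      ∀ (n : ℕ), 1 ≤ n →
      ∀ (δ : ℝ), 0 < δ → δ < 1 →
      ∀ (Δ : ℝ), 0 < Δ →
      ∀ (k : ℕ), k ≤ n →
        C₁ * (√(d * n * Real.log n + n * Real.log (1 / δ)) / Δ) ≤ k →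
      ∀ (p : ℝ),
        (k : ℝ) / n * (1 + C₂ * √((d * Real.log n + Real.log (1 / δ)) / k)) ≤ p →
        KNN.RobustnessGuarantee 𝒳 D η n k r Δ p δ ∧
        KNN.AstutenessGuarantee 𝒳 D η n k r Δ p δ) ∧
    -- second form: explicit conditions in terms of one universal constant
    (∃ C₀ : ℝ, 0 < C₀ ∧
      ∀ (d : ℕ), 1 ≤ d →
      ∀ (𝒳 : Set (KNN.E d)), MeasurableSet 𝒳 →
      ∀ (D : Measure (KNN.Example d)), IsProbabilityMeasure D → D.fst 𝒳ᶜ = 0 →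
      ∀ (η : KNN.E d → ℝ), KNN.IsCondLabelProb D η →
      ∀ (r : ℝ), 0 < r →
      ∀ (n : ℕ), 1 ≤ n →
      ∀ (δ : ℝ), 0 < δ → δ < 1 →
      ∀ (Δ : ℝ), 0 < Δ →
      ∀ (k : ℕ), k ≤ n →
        (2 * KNN.betaTerm d n δ + KNN.bTerm C₀ d n δ +
          √((2 * KNN.betaTerm d n δ + KNN.bTerm C₀ d n δ) ^ 2 +
            2 * Δ * (2 * KNN.betaTerm d n δ ^ 2 + KNN.aTerm C₀ d n δ))) / Δ ≤ (k : ℝ) / n →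
      ∀ (p : ℝ),
        p = (k : ℝ) / n + C₀ / n * (d * Real.log n + Real.log (1 / δ) +
          √(k * (d * Real.log n + Real.log (1 / δ)))) →
        KNN.RobustnessGuarantee 𝒳 D η n k r Δ p δ ∧
        KNN.AstutenessGuarantee 𝒳 D η n k r Δ p δ) ∧
    -- the strict interiors approach those of the Bayes optimal classifier
    (∀ (d : ℕ), 1 ≤ d →
      ∀ (𝒳 : Set (KNN.E d)), IsClosed 𝒳 →
      ∀ (D : Measure (KNN.Example d)), IsProbabilityMeasure D → D.fst 𝒳ᶜ = 0 →
        𝒳 ⊆ D.fst.support →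
      ∀ (η : KNN.E d → ℝ), KNN.IsCondLabelProb D η → ContinuousOn η 𝒳 →
      ∀ (r : ℝ), 0 < r →
      ∀ (Δ p : ℕ → ℝ), (∀ n, 0 < Δ n) → Tendsto Δ atTop (𝓝 0) → Tendsto p atTop (𝓝 0) →
        (∀ n, KNN.strictInteriorPos 𝒳 D.fst η r (Δ n) (p n) ⊆
            KNN.strictInteriorPos 𝒳 D.fst η r 0 0 ∧
          KNN.strictInteriorNeg 𝒳 D.fst η r (Δ n) (p n) ⊆
            KNN.strictInteriorNeg 𝒳 D.fst η r 0 0) ∧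
        ∀ s < r,
          (∀ x ∈ KNN.strictInteriorPos 𝒳 D.fst η r 0 0,
            ∀ᶠ n in atTop, x ∈ KNN.strictInteriorPos 𝒳 D.fst η s (Δ n) (p n)) ∧
          (∀ x ∈ KNN.strictInteriorNeg 𝒳 D.fst η r 0 0,
            ∀ᶠ n in atTop, x ∈ KNN.strictInteriorNeg 𝒳 D.fst η s (Δ n) (p n))) := by
  refine ⟨⟨8, by norm_num, 16, by norm_num, ?_⟩, ⟨16, by norm_num, ?_⟩, ?_⟩
  · intro d hd 𝒳 h𝒳 D _ hD η hη r hr n hn δ h0 h1 Δ hΔ k hk hkΔ p hp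
    refine KNN.guarantees hd h𝒳 hD hη hr hn h0 h1 hΔ hk ?_ hp
    rw [← mul_div_assoc, div_le_iff₀ hΔ] at hkΔ
    convert! hkΔ using 3
    ring
  · intro d hd 𝒳 h𝒳 D _ hD η hη r hr n hn δ h0 h1 Δ hΔ k hk hkΔ p hp
    have hL : 0 < d * Real.log n + Real.log (1 / δ) := KNN.complexity_pos hn h0 h1
    have hn' : (0 : ℝ) < n := by exact_mod_cast hn
    have hk' : (0 : ℝ) ≤ k := Nat.cast_nonneg k
    refine KNN.guarantees hd h𝒳 hD hη hr hn h0 h1 hΔ hk ?_ ?_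
    · -- The `b`-term alone already dominates the condition of the first form.
      rw [div_le_iff₀ hΔ] at hkΔ
      have hβ : 0 ≤ KNN.betaTerm d n δ := Real.sqrt_nonneg _
      have hb : KNN.bTerm 16 d n δ ≤ k / n * Δ :=
        le_trans (by linarith [Real.sqrt_nonneg ((2 * KNN.betaTerm d n δ +
          KNN.bTerm 16 d n δ) ^ 2 + 2 * Δ * (2 * KNN.betaTerm d n δ ^ 2 +
          KNN.aTerm 16 d n δ))]) hkΔ
      have hs : √(n * (d * Real.log n + Real.log (1 / δ))) =
          n * √((d * Real.log n + Real.log (1 / δ)) / n) := by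
        rw [← Real.sqrt_sq hn'.le, ← Real.sqrt_mul (by positivity), Real.sqrt_sq hn'.le]
        congr 1
        field_simp
      have hb' := mul_le_mul_of_nonneg_left hb hn'.le
      rw [KNN.bTerm] at hb'
      have e : n * (k / n * Δ) = k * Δ := by field_simp
      rw [hs]
      have := mul_nonneg hn'.le
        (Real.sqrt_nonneg ((d * Real.log n + Real.log (1 / δ)) / n))
      linarith
    · rw [hp]
      have hs : √(k * (d * Real.log n + Real.log (1 / δ))) =
          k * √((d * Real.log n + Real.log (1 / δ)) / k) := by
        rcases hk'.eq_or_lt with hk0 | hk0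
        · simp [← hk0]
        rw [← Real.sqrt_sq hk0.le, ← Real.sqrt_mul (by positivity), Real.sqrt_sq hk0.le]
        congr 1
        field_simp
      rw [hs]
      have : 0 ≤ 16 / n * (d * Real.log n + Real.log (1 / δ)) := by positivity
      have e : (k : ℝ) / n * (1 + 16 * √((d * Real.log n + Real.log (1 / δ)) / k)) =
          k / n + 16 / n * (k * √((d * Real.log n + Real.log (1 / δ)) / k)) := by ring
      rw [e, mul_add]
      linarith
  · intro d _ 𝒳 h𝒳 D _ _ hsupp η _ hcont r _ Δ p hΔ hΔ0 hp
    simp only [KNN.strictInteriorNeg_eq]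
    exact ⟨fun n => ⟨KNN.strictInteriorPos_subset (hΔ n).le,
        KNN.strictInteriorPos_subset (hΔ n).le⟩,
      fun s hs => ⟨fun x hx =>
        KNN.eventually_mem_strictInteriorPos h𝒳 hsupp hcont hΔ0 hp hs hx,
      fun x hx => KNN.eventually_mem_strictInteriorPos h𝒳 hsupp
        (continuousOn_const.sub hcont) hΔ0 hp hs hx⟩⟩
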